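/- Notation. Let $\mathbb N=\{0,1,2,\dots\}$ and $\ln_+x=\max\{0,\ln x\}$ for $x>0$, $\ln_+0=0$. Let $W$ be the Lambert function on $[0,\infty)$, i.e. the inverse of $w\mapsto we^{w}$ on $[0,\infty)$. A weight function is a non-negative, continuous, even function $\omega:\mathbb R\to\mathbb R$, non-decreasing on $[0,\infty)$, with $\omega(0)=0$, such that ($\alpha$) $\omega(2t)=O(\omega(t))$, ($\beta$) $\omega(t)=O(t)$, ($\gamma$) $\log t=o(\omega(t))$ as $t\to\infty$, and ($\delta$) $t\mapsto\omega(e^t)$ is convex on $\mathbb R$. Functions $f,g$ are equivalent if $f=O(g)$ and $g=O(f)$ as $t\to\infty$. A weight sequence is a sequence $(M_p)_{p\in\mathbb N}$ of positive numbers with $M_0=1\le M_1$, $M_{p+1}^2\le M_pM_{p+2}$ for all $p$, and $M_p^{1/p}\to\infty$. A weight matrix is a family of weight sequences which is totally ordered by the pointwise order. Two weight matrices $\mathcal M,\mathcal N$ are equivalent if $\mathcal M\lesssim\mathcal N$ and $\mathcal N\lesssim\mathcal M$, where $\mathcal M\lesssim\mathcal N$ means: for every $M\in\mathcal M$ there are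 $N\in\mathcal N$ and $C>0$ with $M_p\le C^pN_p$ for all $p\in\mathbb N$. Fix $\sigma>1$. Put $\varphi_\sigma(t)=t^{\sigma/(\sigma-1)}/W(t)^{1/(\sigma-1)}$ for $t>0$, $\varphi_\sigma(0)=0$, and $\varphi_\sigma^*(y)=\sup_{t>0}(yt-\varphi_\sigma(t))$ for $y\ge0$. For $\tau,H>0$ let $M^{\tau}_p=p^{\tau p^\sigma}$ (with $M^{\tau}_0=1$) and $N^{H}_p=\exp(\tfrac1H\varphi_\sigma^*(Hp))$. For $h,\tau>0$ let $$T_{\tau,\sigma,h}(k)=\sup_{p\in\mathbb N}\ln_+\frac{h^{p^\sigma}k^p}{p^{\tau p^\sigma}},\qquad k\ge0 .$$ For a compact set $K\subset\mathbb R^d$ that is regular (i.e. the closure of its interior), $C^\infty(K)$ is the space of complex functions on $K$ that are smooth in the interior of $K$ and all of whose partial derivatives extend continuously to $K$. For a positive sequence $M$, let $\mathcal E_M(K)$ be the space of all $\phi\in C^\infty(K)$ with $$\|\phi\|_{M,K}=\sup_{\alpha\in\mathbb N^d}\sup_{x\in K}\frac{|\partial^\alpha\phi(x)|}{M_{|\alpha|}}<\infty,$$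 with this norm. For $U\subset\mathbb R^d$ open, with $K$ running through the regular compact subsets of $U$, define the following spaces of functions in $C^\infty(U)$, as topological vector spaces (with locally convex inductive limits): $$\mathcal E^{B}_{(\sigma)}(U)=\varprojlim_{K\subset\subset U}\varprojlim_{\tau\to0}\mathcal E_{M^\tau}(K),\qquad \mathcal E^{R}_{\{\sigma\}}(U)=\varprojlim_{K\subset\subset U}\varinjlim_{\tau\to\infty}\mathcal E_{M^\tau}(K),$$ $$\mathcal B_{(\sigma)}(U)=\varprojlim_{K\subset\subset U}\varprojlim_{H\to0}\mathcal E_{N^H}(K),\qquad \mathcal B_{\{\sigma\}}(U)=\varprojlim_{K\subset\subset U}\varinjlim_{H\to\infty}\mathcal E_{N^H}(K).$$ Theorem. Let $\sigma>1$. (i) The function $\omega(k)=\varphi_\sigma(\ln_+|k|)$ is equivalent to a weight function. Moreover, for all $h,\tau>0$ the supremum defining $T_{\tau,\sigma,h}(k)$ is finite for every $k>0$, and $\omega(k)=T_{\tau,\sigma,h}(|k|)$ is equivalent to a weight function. (ii) The supremum defining $\varphi_\sigma^*(y)$ is finite for every $y\ge0$; the families $\{p^{\tau p^\sigma}\}_{\tau>0}$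 and $\{\exp(\tfrac1H\varphi_\sigma^*(Hp))\}_{H>0}$ are weight matrices, and they are equivalent. Moreover, for every $d$ and every open $U\subset\mathbb R^d$, $$\mathcal B_{(\sigma)}(U)=\mathcal E^{B}_{(\sigma)}(U),\qquad \mathcal B_{\{\sigma\}}(U)=\mathcal E^{R}_{\{\sigma\}}(U),$$ as sets and with the same topologies. -/

import Mathlib

open Set Filter Topology Asymptotics
open scoped ContDiff

noncomputable section

namespace ExtGevrey

/-! ### The Lambert function and `φ_σ` -/

/-- The Lambert function on `[0, ∞)`: the inverse of `w ↦ w * exp w` on `[0, ∞)`. -/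
def lambertW (x : ℝ) : ℝ := Function.invFunOn (fun w : ℝ => w * Real.exp w) (Ici 0) x

theorem lambertW_spec {x : ℝ} (hx : 0 ≤ x) :
    0 ≤ lambertW x ∧ lambertW x * Real.exp (lambertW x) = x := by
  have hex : ∃ w ∈ Ici (0 : ℝ), (fun w : ℝ => w * Real.exp w) w = x := by
    have hc : ContinuousOn (fun w : ℝ => w * Real.exp w) (Icc 0 x) := by fun_prop
    have h := intermediate_value_Icc hx hc
    have hmem : x ∈ Icc ((fun w : ℝ => w * Real.exp w) 0) ((fun w : ℝ => w * Real.exp w) x) := by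
      refine ⟨by simpa using hx, ?_⟩
      have := Real.one_le_exp hx
      simpa using le_mul_of_one_le_right hx this
    obtain ⟨w, hw, hwx⟩ := h hmem
    exact ⟨w, hw.1, hwx⟩
  exact Function.invFunOn_pos hex

theorem lambertW_mul_exp {w : ℝ} (hw : 0 ≤ w) : lambertW (w * Real.exp w) = w := by
  have h := lambertW_spec (mul_nonneg hw (Real.exp_pos w).le)
  have hmono : StrictMonoOn (fun w : ℝ => w * Real.exp w) (Ici 0) := by
    intro a ha b _ hab
    have ha' : (0 : ℝ) ≤ a := ha
    exact mul_lt_mul hab (Real.exp_le_exp.2 hab.le) (Real.exp_pos a) (ha'.trans hab.le)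
  exact hmono.injOn h.1 hw h.2

/-- `φ_σ(t) = t ^ (σ/(σ-1)) / W(t) ^ (1/(σ-1))` for `t > 0`, and `φ_σ(0) = 0`. -/
def phi (σ t : ℝ) : ℝ :=
  if 0 < t then t ^ (σ / (σ - 1)) / lambertW t ^ (1 / (σ - 1)) else 0

/-! ### Weight functions -/

/-- Weight functions in the sense of Braun--Meise--Taylor and Bonet--Meise--Melikhov.
"Increasing" refers to `[0, ∞)` and is not strict: for instance `ln₊ |t| ^ s`, `s > 1`, is
a weight function. -/
structure IsWeightFunction (w : ℝ → ℝ) : Prop where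
  nonneg : ∀ t, 0 ≤ w t
  continuous : Continuous w
  even : ∀ t, w (-t) = w t
  monotoneOn : MonotoneOn w (Ici 0)
  map_zero : w 0 = 0
  alpha : (fun t => w (2 * t)) =O[atTop] w
  beta : w =O[atTop] (fun t : ℝ => t)
  gamma : Real.log =o[atTop] w
  delta : ConvexOn ℝ univ (fun t => w (Real.exp t))

/-- Equivalence `f ≍ g` of functions, as the argument tends to infinity. -/
def Equivalent (f g : ℝ → ℝ) : Prop := f =O[atTop] g ∧ g =O[atTop] f

def EquivalentToWeight (f : ℝ → ℝ) : Prop := ∃ w, IsWeightFunction w ∧ Equivalent f w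

/-! ### The sequences `p ^ (τ p ^ σ)` and their associated functions -/

/-- `M_p = p ^ (τ * p ^ σ)`; for `p = 0` this is `0 ^ 0 = 1`. -/
def gevreySeq (σ τ : ℝ) (p : ℕ) : ℝ := (p : ℝ) ^ (τ * (p : ℝ) ^ σ)

/-- `ln₊ (h ^ (p ^ σ) * k ^ p / M_p)`. -/
def assocTerm (σ τ h k : ℝ) (p : ℕ) : ℝ :=
  Real.posLog (h ^ ((p : ℝ) ^ σ) * k ^ p / gevreySeq σ τ p)

/-- The associated function `T_{τ,σ,h}(k)`, the supremum of the above over all `p`. -/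
def assocFun (σ τ h k : ℝ) : ℝ := ⨆ p : ℕ, assocTerm σ τ h k p

/-! ### Young conjugate and weight matrices -/

/-- `φ^*(y) = sup_{t > 0} (y t - φ(t))`. -/
def youngConj (φ : ℝ → ℝ) (y : ℝ) : ℝ := ⨆ t : Ioi (0 : ℝ), (y * t - φ t)

/-- `exp ((1/H) φ_σ^*(H p))`. -/
def youngSeq (σ H : ℝ) (p : ℕ) : ℝ := Real.exp (1 / H * youngConj (phi σ) (H * p))

/-- Weight sequences: normalized, log-convex, with `M_p ^ (1/p) → ∞`. -/
structure IsWeightSequence (M : ℕ → ℝ) : Prop where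
  pos : ∀ p, 0 < M p
  zero : M 0 = 1
  one : 1 ≤ M 1
  logConvex : ∀ p, M (p + 1) ^ 2 ≤ M p * M (p + 2)
  root : Tendsto (fun p : ℕ => M p ^ (1 / (p : ℝ))) atTop atTop

/-- A weight matrix: a family of weight sequences totally ordered by the pointwise order. -/
def IsWeightMatrix (A : Set (ℕ → ℝ)) : Prop :=
  (∀ M ∈ A, IsWeightSequence M) ∧
    ∀ M ∈ A, ∀ N ∈ A, (∀ p, M p ≤ N p) ∨ (∀ p, N p ≤ M p)

def MatrixLE (A B : Set (ℕ → ℝ)) : Prop :=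
  ∀ M ∈ A, ∃ N ∈ B, ∃ C : ℝ, 0 < C ∧ ∀ p : ℕ, M p ≤ C ^ p * N p

def MatrixEquiv (A B : Set (ℕ → ℝ)) : Prop := MatrixLE A B ∧ MatrixLE B A

def gevreyMatrix (σ : ℝ) : Set (ℕ → ℝ) := {M | ∃ τ : ℝ, 0 < τ ∧ M = gevreySeq σ τ}

def youngMatrix (σ : ℝ) : Set (ℕ → ℝ) := {M | ∃ H : ℝ, 0 < H ∧ M = youngSeq σ H}

/-! ### Partial derivatives -/

variable {d : ℕ}

/-- The partial derivative `∂_i f`. -/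
def pderiv (i : Fin d) (f : EuclideanSpace ℝ (Fin d) → ℂ) : EuclideanSpace ℝ (Fin d) → ℂ :=
  fun x => fderiv ℝ f x (EuclideanSpace.single i 1)

/-- `∂^α f = ∂_1^{α_1} ⋯ ∂_d^{α_d} f`. -/
def iterPDeriv (α : Fin d → ℕ) (f : EuclideanSpace ℝ (Fin d) → ℂ) :
    EuclideanSpace ℝ (Fin d) → ℂ :=
  (List.finRange d).foldr (fun i g => (pderiv i)^[α i] g) f

theorem iterPDeriv_induct
    {R : (EuclideanSpace ℝ (Fin d) → ℂ) → (EuclideanSpace ℝ (Fin d) → ℂ) →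
      (EuclideanSpace ℝ (Fin d) → ℂ) → Prop}
    (hR : ∀ i f g h, R f g h → R (pderiv i f) (pderiv i g) (pderiv i h))
    (α : Fin d → ℕ) {f g h : EuclideanSpace ℝ (Fin d) → ℂ} (H : R f g h) :
    R (iterPDeriv α f) (iterPDeriv α g) (iterPDeriv α h) := by
  unfold iterPDeriv
  have iter : ∀ (i : Fin d) (n : ℕ) (f g h : EuclideanSpace ℝ (Fin d) → ℂ), R f g h →
      R ((pderiv i)^[n] f) ((pderiv i)^[n] g) ((pderiv i)^[n] h) := by
    intro i n
    induction n with
    | zero => intro f g h H; exact H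
    | succ n ih => intro f g h H; exact ih _ _ _ (hR i _ _ _ H)
  induction List.finRange d with
  | nil => exact H
  | cons i l ih => exact iter i _ _ _ _ ih

theorem pderiv_contDiffOn {s : Set (EuclideanSpace ℝ (Fin d))} (hs : IsOpen s) (i : Fin d)
    {f : EuclideanSpace ℝ (Fin d) → ℂ} (hf : ContDiffOn ℝ ∞ f s) :
    ContDiffOn ℝ ∞ (pderiv i f) s :=
  (hf.fderiv_of_isOpen hs (by simp)).clm_apply contDiffOn_const

theorem pderiv_eqOn {s : Set (EuclideanSpace ℝ (Fin d))} (hs : IsOpen s) (i : Fin d)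
    {f g : EuclideanSpace ℝ (Fin d) → ℂ} (h : EqOn f g s) :
    EqOn (pderiv i f) (pderiv i g) s := by
  intro x hx
  have : f =ᶠ[𝓝 x] g := Filter.eventuallyEq_of_mem (hs.mem_nhds hx) h
  simp only [pderiv, this.fderiv_eq]

theorem iterPDeriv_contDiffOn {s : Set (EuclideanSpace ℝ (Fin d))} (hs : IsOpen s)
    (α : Fin d → ℕ) {f : EuclideanSpace ℝ (Fin d) → ℂ} (hf : ContDiffOn ℝ ∞ f s) :
    ContDiffOn ℝ ∞ (iterPDeriv α f) s :=
  iterPDeriv_induct (R := fun f _ _ => ContDiffOn ℝ ∞ f s)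
    (fun i _ _ _ h => pderiv_contDiffOn hs i h) α (g := f) (h := f) hf

theorem iterPDeriv_eqOn {s : Set (EuclideanSpace ℝ (Fin d))} (hs : IsOpen s)
    (α : Fin d → ℕ) {f g : EuclideanSpace ℝ (Fin d) → ℂ} (h : EqOn f g s) :
    EqOn (iterPDeriv α f) (iterPDeriv α g) s :=
  iterPDeriv_induct (R := fun f g _ => EqOn f g s)
    (fun i _ _ _ h => pderiv_eqOn hs i h) α (h := f) h

theorem iterPDeriv_add {s : Set (EuclideanSpace ℝ (Fin d))} (hs : IsOpen s)
    (α : Fin d → ℕ) {f g : EuclideanSpace ℝ (Fin d) → ℂ}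
    (hf : ContDiffOn ℝ ∞ f s) (hg : ContDiffOn ℝ ∞ g s) :
    EqOn (iterPDeriv α (f + g)) (iterPDeriv α f + iterPDeriv α g) s := by
  refine (iterPDeriv_induct
    (R := fun f g h => ContDiffOn ℝ ∞ f s ∧ ContDiffOn ℝ ∞ g s ∧ EqOn h (f + g) s)
    ?_ α ⟨hf, hg, fun x _ => rfl⟩).2.2
  rintro i f g h ⟨hf, hg, e⟩
  refine ⟨pderiv_contDiffOn hs i hf, pderiv_contDiffOn hs i hg, fun x hx => ?_⟩
  rw [pderiv_eqOn hs i e hx]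
  have h1 := (hf.contDiffAt (hs.mem_nhds hx)).differentiableAt (by simp)
  have h2 := (hg.contDiffAt (hs.mem_nhds hx)).differentiableAt (by simp)
  simp [pderiv, fderiv_add h1 h2]

theorem iterPDeriv_smul {s : Set (EuclideanSpace ℝ (Fin d))} (hs : IsOpen s)
    (α : Fin d → ℕ) (c : ℂ) {f : EuclideanSpace ℝ (Fin d) → ℂ} (hf : ContDiffOn ℝ ∞ f s) :
    EqOn (iterPDeriv α (c • f)) (c • iterPDeriv α f) s := by
  refine (iterPDeriv_induct
    (R := fun f g _ => ContDiffOn ℝ ∞ f s ∧ EqOn g (c • f) s)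
    ?_ α (h := f) ⟨hf, fun x _ => rfl⟩).2
  rintro i f g _ ⟨hf, e⟩
  refine ⟨pderiv_contDiffOn hs i hf, fun x hx => ?_⟩
  rw [pderiv_eqOn hs i e hx]
  have h1 := (hf.contDiffAt (hs.mem_nhds hx)).differentiableAt (by simp)
  simp [pderiv, fderiv_const_smul h1 c]

/-! ### The spaces `C^∞(U)` and `C^∞(K)` -/

/-- Extension by zero of a function on a subset. -/
def zeroExt {s : Set (EuclideanSpace ℝ (Fin d))} (f : s → ℂ) : EuclideanSpace ℝ (Fin d) → ℂ :=
  Function.extend Subtype.val f 0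

theorem zeroExt_apply {s : Set (EuclideanSpace ℝ (Fin d))} (f : s → ℂ) (x : s) :
    zeroExt f x = f x := Subtype.val_injective.extend_apply f 0 x

theorem zeroExt_add {s : Set (EuclideanSpace ℝ (Fin d))} (f g : s → ℂ) :
    zeroExt (f + g) = zeroExt f + zeroExt g := by
  unfold zeroExt
  rw [← Function.extend_add, add_zero]

theorem zeroExt_smul {s : Set (EuclideanSpace ℝ (Fin d))} (c : ℂ) (f : s → ℂ) :
    zeroExt (c • f) = c • zeroExt f := by
  unfold zeroExt
  rw [← Function.extend_smul, smul_zero]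

theorem zeroExt_zero {s : Set (EuclideanSpace ℝ (Fin d))} :
    zeroExt (0 : s → ℂ) = 0 := by
  have := zeroExt_smul (0 : ℂ) (0 : s → ℂ)
  simpa using this

/-- `C^∞(U)`, for `U` open: the smooth functions `U → ℂ`. -/
def smoothOpen (U : Set (EuclideanSpace ℝ (Fin d))) : Submodule ℂ (U → ℂ) where
  carrier := {f | ContDiffOn ℝ ∞ (zeroExt f) U}
  add_mem' {f g} hf hg := by
    simp only [mem_ofPred_eq, zeroExt_add] at *
    exact hf.add hg
  zero_mem' := by
    simp only [mem_ofPred_eq, zeroExt_zero]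
    exact contDiffOn_const
  smul_mem' c f hf := by
    simp only [mem_ofPred_eq, zeroExt_smul] at *
    exact contDiffOn_const.smul hf

/-- `C^∞(K)`, for `K` a regular compact set: the functions on `K` that are smooth in the
interior of `K` and all of whose partial derivatives extend continuously to `K`. Such a function
`F 0` is given together with the (unique, as the interior is dense in `K`) continuous extensions
`F α` of its partial derivatives `∂^α (F 0)`. -/
def smoothCompact (K : Set (EuclideanSpace ℝ (Fin d))) :
    Submodule ℂ ((Fin d → ℕ) → K → ℂ) where
  carrier := {F | (∀ α, Continuous (F α)) ∧ ContDiffOn ℝ ∞ (zeroExt (F 0)) (interior K) ∧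
    ∀ α, ∀ x : K, (x : EuclideanSpace ℝ (Fin d)) ∈ interior K →
      F α x = iterPDeriv α (zeroExt (F 0)) x}
  add_mem' {F G} hF hG := by
    refine ⟨fun α => (hF.1 α).add (hG.1 α), ?_, fun α x hx => ?_⟩
    · rw [Pi.add_apply, zeroExt_add]
      exact hF.2.1.add hG.2.1
    · rw [Pi.add_apply, Pi.add_apply, Pi.add_apply, zeroExt_add,
        iterPDeriv_add isOpen_interior α hF.2.1 hG.2.1 hx, Pi.add_apply,
        hF.2.2 α x hx, hG.2.2 α x hx]
  zero_mem' := by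
    have h0 : ContDiffOn ℝ ∞ (0 : EuclideanSpace ℝ (Fin d) → ℂ) (interior K) := contDiffOn_const
    refine ⟨fun α => continuous_const, ?_, fun α x hx => ?_⟩
    · rw [Pi.zero_apply, zeroExt_zero]
      exact h0
    · have := iterPDeriv_smul isOpen_interior α (0 : ℂ) h0 hx
      rw [Pi.zero_apply, Pi.zero_apply, Pi.zero_apply, zeroExt_zero]
      simpa using this.symm
  smul_mem' c F hF := by
    refine ⟨fun α => (hF.1 α).const_smul c, ?_, fun α x hx => ?_⟩
    · rw [Pi.smul_apply, zeroExt_smul]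
      exact contDiffOn_const.smul hF.2.1
    · rw [Pi.smul_apply, Pi.smul_apply, Pi.smul_apply, zeroExt_smul,
        iterPDeriv_smul isOpen_interior α c hF.2.1 hx, Pi.smul_apply, hF.2.2 α x hx]

/-- The regular compact subsets of `U`. -/
structure RegularCompact (U : Set (EuclideanSpace ℝ (Fin d))) where
  carrier : Set (EuclideanSpace ℝ (Fin d))
  isCompact : IsCompact carrier
  regular : closure (interior carrier) = carrier
  subset : carrier ⊆ U

/-- The restriction map `C^∞(U) → C^∞(K)`. -/
def restrictTo {U : Set (EuclideanSpace ℝ (Fin d))} (hU : IsOpen U) (K : RegularCompact U) :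
    smoothOpen U →ₗ[ℂ] smoothCompact K.carrier where
  toFun f := ⟨fun α x => iterPDeriv α (zeroExt f.1) x, by
    have hf : ContDiffOn ℝ ∞ (zeroExt f.1) U := f.2
    have hK : interior K.carrier ⊆ U := interior_subset.trans K.subset
    have h0 : iterPDeriv 0 (zeroExt f.1) = zeroExt f.1 := by
      unfold iterPDeriv
      induction List.finRange d with
      | nil => rfl
      | cons i l ih => simpa using ih
    have e : EqOn (zeroExt (fun x : K.carrier => iterPDeriv 0 (zeroExt f.1) x)) (zeroExt f.1)
        (interior K.carrier) := by
      intro x hx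
      rw [h0]
      exact zeroExt_apply (fun x : K.carrier => zeroExt f.1 x) ⟨x, interior_subset hx⟩
    refine ⟨fun α => ?_, (hf.mono hK).congr e, fun α x hx => ?_⟩
    · exact ((iterPDeriv_contDiffOn hU α hf).continuousOn.mono K.subset).domRestrict
    · exact (iterPDeriv_eqOn isOpen_interior α e hx).symm⟩
  map_add' f g := by
    ext α x
    simpa [zeroExt_add] using iterPDeriv_add hU α f.2 g.2 (K.subset x.2)
  map_smul' c f := by
    ext α x
    simpa [zeroExt_smul] using iterPDeriv_smul hU α c f.2 (K.subset x.2)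

/-! ### Banach spaces of ultradifferentiable functions on `K` -/

/-- The quotients `|∂^α F(x)| / M_{|α|}`, indexed by pairs `(α, x)`. The sequences used as `M` are
positive; the absolute value only makes the definitions below meaningful for every `M`. -/
def quot (K : Set (EuclideanSpace ℝ (Fin d))) (M : ℕ → ℝ) (F : smoothCompact K)
    (q : (Fin d → ℕ) × K) : ℝ :=
  ‖F.1 q.1 q.2‖ / |M (∑ i, q.1 i)|

theorem quot_nonneg (K : Set (EuclideanSpace ℝ (Fin d))) (M : ℕ → ℝ) (F : smoothCompact K)
    (q : (Fin d → ℕ) × K) : 0 ≤ quot K M F q := by unfold quot; positivity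

theorem quot_add (K : Set (EuclideanSpace ℝ (Fin d))) (M : ℕ → ℝ) (F G : smoothCompact K)
    (q : (Fin d → ℕ) × K) : quot K M (F + G) q ≤ quot K M F q + quot K M G q := by
  unfold quot
  rw [← add_div]
  gcongr
  exact norm_add_le _ _

theorem quot_smul (K : Set (EuclideanSpace ℝ (Fin d))) (M : ℕ → ℝ) (c : ℂ) (F : smoothCompact K)
    (q : (Fin d → ℕ) × K) : quot K M (c • F) q = ‖c‖ * quot K M F q := by
  unfold quot
  rw [← mul_div_assoc, ← norm_smul]
  rfl

/-- The space of all `F ∈ C^∞(K)` with `sup_α sup_{x ∈ K} |∂^α F(x)| / M_{|α|} < ∞`. -/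
def udSpace (K : Set (EuclideanSpace ℝ (Fin d))) (M : ℕ → ℝ) :
    Submodule ℂ (smoothCompact K) where
  carrier := {F | BddAbove (range (quot K M F))}
  add_mem' {F G} hF hG := by
    obtain ⟨a, ha⟩ := hF
    obtain ⟨b, hb⟩ := hG
    refine ⟨a + b, ?_⟩
    rintro _ ⟨q, rfl⟩
    exact (quot_add K M F G q).trans (add_le_add (ha ⟨q, rfl⟩) (hb ⟨q, rfl⟩))
  zero_mem' := by
    refine ⟨0, ?_⟩
    rintro _ ⟨q, rfl⟩
    simp [quot]
  smul_mem' c F hF := by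
    obtain ⟨a, ha⟩ := hF
    refine ⟨‖c‖ * a, ?_⟩
    rintro _ ⟨q, rfl⟩
    rw [quot_smul]
    exact mul_le_mul_of_nonneg_left (ha ⟨q, rfl⟩) (norm_nonneg c)

/-- The norm `sup_α sup_{x ∈ K} |∂^α F(x)| / M_{|α|}` of `udSpace K M`. -/
def udNorm (K : Set (EuclideanSpace ℝ (Fin d))) (M : ℕ → ℝ) : Seminorm ℂ (udSpace K M) :=
  Seminorm.of (fun F => ⨆ q, quot K M F.1 q)
    (fun F G => Real.iSup_le
      (fun q => (quot_add K M F.1 G.1 q).trans (add_le_add (le_ciSup F.2 q) (le_ciSup G.2 q)))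
      (add_nonneg (Real.iSup_nonneg (quot_nonneg K M F.1))
        (Real.iSup_nonneg (quot_nonneg K M G.1))))
    (fun c F => by
      rw [Real.mul_iSup_of_nonneg (norm_nonneg c)]
      exact congrArg _ (funext fun q => quot_smul K M c F.1 q))

/-- The norm topology of `udSpace K M`. -/
@[reducible]
def udTopology (K : Set (EuclideanSpace ℝ (Fin d))) (M : ℕ → ℝ) :
    TopologicalSpace (udSpace K M) :=
  (udNorm K M).toAddGroupSeminorm.toSeminormedAddCommGroup.toPseudoMetricSpace.toUniformSpace.toTopologicalSpace

/-! ### Inductive and projective limits -/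

/-- A subspace of `V` together with a topology on it; equality of two of these means that
the subspaces and their topologies coincide. -/
structure TopSubspace (V : Type*) [AddCommGroup V] [Module ℂ V] where
  carrier : Submodule ℂ V
  topology : TopologicalSpace carrier

/-- The locally convex inductive limit of the subspaces `S i` of `V` with topologies `t i`: their
sum (the union, if they are directed) with the finest locally convex vector space topology that
makes all inclusions continuous. In the order on topologies, smaller means finer. -/
def inductiveLimit {ι V : Type*} [AddCommGroup V] [Module ℂ V] (S : ι → Submodule ℂ V)
    (t : ∀ i, TopologicalSpace (S i)) : TopSubspace V where
  carrier := ⨆ i, S i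
  topology := sInf {T : TopologicalSpace (⨆ i, S i : Submodule ℂ V) |
    @IsTopologicalAddGroup _ T _ ∧ @ContinuousSMul ℂ _ _ _ T ∧
      @LocallyConvexSpace ℝ _ _ _ _ _ T ∧
      ∀ i, @Continuous _ _ (t i) T (Submodule.inclusion (le_iSup S i))}

/-- The projective limit of the spaces `X k` along the maps `r k`: all `f` with `r k f ∈ X k`
for all `k`, with the coarsest topology that makes all the maps to `X k` continuous. -/
def projectiveLimit {κ V : Type*} {W : κ → Type*} [AddCommGroup V] [Module ℂ V]
    [∀ k, AddCommGroup (W k)] [∀ k, Module ℂ (W k)] (r : ∀ k, V →ₗ[ℂ] W k)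
    (X : ∀ k, TopSubspace (W k)) : TopSubspace V where
  carrier := ⨅ k, (X k).carrier.comap (r k)
  topology := ⨅ k, (X k).topology.induced
    ((r k).restrict (fun _ hf => (Submodule.mem_iInf _).1 hf k))

/-- The Roumieu class of a family `M a`, `a > 0`, of sequences: the projective limit over the
regular compact sets `K ⊆ U` of the inductive limit, over `a > 0`, of the spaces `udSpace K (M a)`. -/
def roumieuClass {U : Set (EuclideanSpace ℝ (Fin d))} (hU : IsOpen U) (M : ℝ → ℕ → ℝ) :
    TopSubspace (smoothOpen U) :=
  projectiveLimit (fun K : RegularCompact U => restrictTo hU K)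
    (fun K => inductiveLimit (fun a : Ioi (0 : ℝ) => udSpace K.carrier (M a))
      (fun a => udTopology K.carrier (M a)))

/-- The Beurling class of a family `M a`, `a > 0`, of sequences: the projective limit over the
regular compact sets `K ⊆ U` of the projective limit, over `a > 0`, of the spaces
`udSpace K (M a)`. -/
def beurlingClass {U : Set (EuclideanSpace ℝ (Fin d))} (hU : IsOpen U) (M : ℝ → ℕ → ℝ) :
    TopSubspace (smoothOpen U) :=
  projectiveLimit (fun K : RegularCompact U => restrictTo hU K)
    (fun K => projectiveLimit (fun _ : Ioi (0 : ℝ) => LinearMap.id)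
      (fun a => ⟨udSpace K.carrier (M a), udTopology K.carrier (M a)⟩))

end ExtGevrey

end

/-!
With `w = W(t)` one has `t / W(t) = exp w`, hence `φ_σ(t) = t exp (w / (σ - 1))` (`phi_eq`), and
everything is computed in the variable `w`.

*Weight functions.* The derivative of `φ_σ` is an increasing function of `w`, so `φ_σ` is convex,
and the elementary estimates `W(2t) ≤ W(t) + log 2`, `W(t) ≤ log t` and `W(t) → ∞` make
`k ↦ φ_σ(ln₊ |k|)` itself a weight function (`isWeightFunction_phi`). The associated function
`T_{τ,σ,h}` is comparable to it: for `x = log k`, the expression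
`p x - τ p ^ σ log p + p ^ σ log h` is at most `0` once `p` exceeds a large multiple of
`exp (w / (σ - 1))`, and it is at least `p x / 2` when `p` is a small multiple of
`exp (w / (σ - 1))` (`exists_assocTerm_le`, `exists_le_assocFun`). So both functions are
equivalent to the same weight function.

*Weight matrices.* Since `y t - φ_σ(t) = w exp w (y - exp (w / (σ - 1)))`, the Young conjugate
satisfies
`(σ - 1) (y / 2) ^ σ log (y / 2) ≤ φ_σ^*(y) ≤ (σ - 1) y ^ σ ln₊ y`
(`le_youngConj_phi_of_pos`, `youngConj_phi_le`). Therefore `(1 / H) φ_σ^*(H p)` and `τ p ^ σ log p`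
dominate each other up to additive constants, where `τ` is comparable to `H ^ (σ - 1)`; as
`σ > 1`, small `H` correspond to small `τ` and large `H` to large `τ`. The four resulting
comparisons, two for large and two for small parameters, give the equivalence of the matrices and
the mutual cofinality of the two families of Banach spaces on each compact set.

*Function spaces.* Families of subspaces that are cofinal in each other through continuous
inclusions have the same inductive and the same projective limit, with the same topology
(`inductiveLimit_eq`, `projectiveLimit_eq`).
-/

namespace ExtGevrey

/-! ### The Lambert function -/

theorem lambertW_nonneg {x : ℝ} (hx : 0 ≤ x) : 0 ≤ lambertW x := (lambertW_spec hx).1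

theorem mul_exp_le_mul_exp {a b : ℝ} (ha : 0 ≤ a) (hab : a ≤ b) :
    a * Real.exp a ≤ b * Real.exp b :=
  mul_le_mul hab (Real.exp_le_exp.2 hab) (Real.exp_pos a).le (ha.trans hab)

theorem lambertW_le_iff {x w : ℝ} (hx : 0 ≤ x) :
    lambertW x ≤ w ↔ x ≤ w * Real.exp w := by
  obtain ⟨h0, h1⟩ := lambertW_spec hx
  constructor
  · intro h
    exact h1.symm.le.trans (mul_exp_le_mul_exp h0 h)
  · intro h
    by_contra! hlt
    have : w * Real.exp w < lambertW x * Real.exp (lambertW x) :=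
      mul_lt_mul hlt (Real.exp_le_exp.2 hlt.le) (Real.exp_pos w) h0
    linarith

theorem le_lambertW_iff {x w : ℝ} (hx : 0 ≤ x) (hw : 0 ≤ w) :
    w ≤ lambertW x ↔ w * Real.exp w ≤ x := by
  obtain ⟨h0, h1⟩ := lambertW_spec hx
  constructor
  · intro h
    exact (mul_exp_le_mul_exp hw h).trans h1.le
  · intro h
    by_contra! hlt
    have : lambertW x * Real.exp (lambertW x) < w * Real.exp w :=
      mul_lt_mul hlt (Real.exp_le_exp.2 hlt.le) (Real.exp_pos _) hw
    linarith

theorem lambertW_mono {x y : ℝ} (hx : 0 ≤ x) (hxy : x ≤ y) : lambertW x ≤ lambertW y := by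
  rw [lambertW_le_iff hx, (lambertW_spec (hx.trans hxy)).2]
  exact hxy

theorem lambertW_pos {x : ℝ} (hx : 0 < x) : 0 < lambertW x := by
  obtain ⟨h0, h1⟩ := lambertW_spec hx.le
  refine h0.lt_of_ne fun h => ?_
  rw [← h] at h1
  simp at h1
  linarith

theorem lambertW_sub_le {x y : ℝ} (hx : 0 ≤ x) (hxy : x ≤ y) :
    lambertW y - lambertW x ≤ y - x := by
  obtain ⟨h0, h1⟩ := lambertW_spec hx
  suffices lambertW y ≤ lambertW x + (y - x) by linarith
  have hd : 0 ≤ y - x := by linarith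
  rw [lambertW_le_iff (hx.trans hxy)]
  have e1 : Real.exp (lambertW x) ≤ Real.exp (lambertW x + (y - x)) :=
    Real.exp_le_exp.2 (by linarith)
  have e2 : 1 ≤ Real.exp (lambertW x + (y - x)) := Real.one_le_exp (by linarith)
  nlinarith

theorem continuousOn_lambertW : ContinuousOn lambertW (Ici 0) := by
  have : LipschitzOnWith 1 lambertW (Ici 0) := by
    refine LipschitzOnWith.of_dist_le_mul fun x hx y hy => ?_
    rw [NNReal.coe_one, one_mul, Real.dist_eq, Real.dist_eq]
    have hx : 0 ≤ x := hx
    have hy : 0 ≤ y := hy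
    rcases le_total x y with h | h
    · rw [abs_sub_comm, abs_sub_comm x, abs_of_nonneg (sub_nonneg.2 (lambertW_mono hx h)),
        abs_of_nonneg (sub_nonneg.2 h)]
      exact lambertW_sub_le hx h
    · rw [abs_of_nonneg (sub_nonneg.2 (lambertW_mono hy h)), abs_of_nonneg (sub_nonneg.2 h)]
      exact lambertW_sub_le hy h
  exact this.continuousOn

theorem hasDerivAt_lambertW {x : ℝ} (hx : 0 < x) :
    HasDerivAt lambertW (Real.exp (lambertW x) * (1 + lambertW x))⁻¹ x := by
  have hc : ContinuousAt lambertW x := continuousOn_lambertW.continuousAt (Ici_mem_nhds hx)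
  have h0 := lambertW_nonneg hx.le
  have hd : HasDerivAt (fun w : ℝ => w * Real.exp w)
      (Real.exp (lambertW x) * (1 + lambertW x)) (lambertW x) := by
    refine ((hasDerivAt_id (lambertW x)).mul (Real.hasDerivAt_exp (lambertW x))).congr_deriv ?_
    simp only [id]
    ring
  refine hd.of_local_left_inverse hc (by positivity) ?_
  filter_upwards [Ici_mem_nhds hx] with y hy using (lambertW_spec hy).2

theorem lambertW_two_mul_le {x : ℝ} (hx : 0 ≤ x) :
    lambertW (2 * x) ≤ lambertW x + Real.log 2 := by
  obtain ⟨h0, h1⟩ := lambertW_spec hx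
  have hl : 0 < Real.log 2 := Real.log_pos (by norm_num)
  rw [lambertW_le_iff (by linarith), Real.exp_add, Real.exp_log (by norm_num)]
  nlinarith [Real.exp_pos (lambertW x), mul_pos hl (Real.exp_pos (lambertW x))]

theorem lambertW_le_log {x : ℝ} (hx : Real.exp 1 ≤ x) : lambertW x ≤ Real.log x := by
  have hx0 : 0 < x := (Real.exp_pos 1).trans_le hx
  have h1 : 1 ≤ Real.log x := (Real.le_log_iff_exp_le hx0).2 hx
  rw [lambertW_le_iff hx0.le, Real.exp_log hx0]
  nlinarith

theorem tendsto_lambertW : Tendsto lambertW atTop atTop := by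
  refine tendsto_atTop.2 fun b => ?_
  filter_upwards [eventually_ge_atTop (max b 0 * Real.exp (max b 0))] with x hx
  have h0 : 0 ≤ max b 0 := le_max_right _ _
  have hx0 : 0 ≤ x := (by positivity : 0 ≤ max b 0 * Real.exp (max b 0)).trans hx
  exact (le_max_left b 0).trans ((le_lambertW_iff hx0 h0).2 hx)

/-! ### The function `φ_σ` -/

/-- Since `t / W(t) = exp W(t)`, this is the form of `φ_σ` in which it is easy to estimate: in the
variable `w = W(t)`, it says that `φ_σ(t) = w exp (w σ / (σ - 1))`. -/
theorem phi_eq {σ t : ℝ} (hσ : 1 < σ) (ht : 0 ≤ t) :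
    phi σ t = t * Real.exp (lambertW t / (σ - 1)) := by
  have hs : 0 < σ - 1 := by linarith
  rcases ht.eq_or_lt with rfl | ht
  · simp [phi]
  · have hw := lambertW_pos ht
    have h : t / lambertW t = Real.exp (lambertW t) := by
      rw [div_eq_iff hw.ne', mul_comm, (lambertW_spec ht.le).2]
    have e : σ / (σ - 1) = 1 + 1 / (σ - 1) := by field_simp; ring
    rw [phi, if_pos ht, e, Real.rpow_add ht, Real.rpow_one, mul_div_assoc,
      ← Real.div_rpow ht.le hw.le, h, ← Real.exp_mul, mul_one_div]

theorem phi_zero (σ : ℝ) : phi σ 0 = 0 := by simp [phi]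

theorem phi_nonneg {σ t : ℝ} (hσ : 1 < σ) (ht : 0 ≤ t) : 0 ≤ phi σ t := by
  rw [phi_eq hσ ht]; positivity

theorem phi_mono {σ : ℝ} (hσ : 1 < σ) : MonotoneOn (phi σ) (Ici 0) := by
  intro a ha b hb hab
  have ha : 0 ≤ a := ha
  have hb : 0 ≤ b := hb
  have hs : 0 < σ - 1 := by linarith
  rw [phi_eq hσ ha, phi_eq hσ hb]
  gcongr
  exact lambertW_mono ha hab

theorem continuousOn_phi {σ : ℝ} (hσ : 1 < σ) : ContinuousOn (phi σ) (Ici 0) :=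
  (continuousOn_id.mul (Real.continuous_exp.comp_continuousOn
    (continuousOn_lambertW.div_const (σ - 1)))).congr fun _ ht => phi_eq hσ ht

theorem hasDerivAt_phi {σ t : ℝ} (hσ : 1 < σ) (ht : 0 < t) :
    HasDerivAt (phi σ) (Real.exp (lambertW t / (σ - 1)) *
      (1 + 1 / (σ - 1) * (1 - 1 / (1 + lambertW t)))) t := by
  have hw := lambertW_pos ht
  have hs : 0 < σ - 1 := by linarith
  have h := (hasDerivAt_id t).mul ((hasDerivAt_lambertW ht).div_const (σ - 1)).exp
  refine (h.congr_of_eventuallyEq ?_).congr_deriv ?_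
  · filter_upwards [Ici_mem_nhds ht] with y hy using phi_eq hσ hy
  · have e : t = lambertW t * Real.exp (lambertW t) := (lambertW_spec ht.le).2.symm
    simp only [id]
    have h1 : t * (Real.exp (lambertW t) * (1 + lambertW t))⁻¹ = 1 - 1 / (1 + lambertW t) := by
      nth_rewrite 1 [e]
      field_simp
      ring
    have h2 : t * (Real.exp (lambertW t / (σ - 1)) *
        ((Real.exp (lambertW t) * (1 + lambertW t))⁻¹ / (σ - 1))) =
        Real.exp (lambertW t / (σ - 1)) * (1 / (σ - 1) *
          (t * (Real.exp (lambertW t) * (1 + lambertW t))⁻¹)) := by ring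
    rw [h2, h1]
    ring

theorem convexOn_phi {σ : ℝ} (hσ : 1 < σ) : ConvexOn ℝ (Ici 0) (phi σ) := by
  have hs : 0 < σ - 1 := by linarith
  refine MonotoneOn.convexOn_of_deriv (convex_Ici 0) (continuousOn_phi hσ) ?_ ?_
  · rw [interior_Ici]
    exact fun t ht => (hasDerivAt_phi hσ ht).differentiableAt.differentiableWithinAt
  · rw [interior_Ici]
    intro a ha b hb hab
    have ha' : 0 < a := ha
    rw [(hasDerivAt_phi hσ ha).deriv, (hasDerivAt_phi hσ hb).deriv]
    have hwa := lambertW_pos ha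
    have hwab := lambertW_mono ha'.le hab
    have h1 : 1 / (1 + lambertW a) ≤ 1 := by
      rw [div_le_one (by linarith)]; linarith
    have : 0 ≤ 1 / (σ - 1) * (1 - 1 / (1 + lambertW a)) :=
      mul_nonneg (by positivity) (by linarith)
    gcongr

theorem phi_two_mul_le {σ t : ℝ} (hσ : 1 < σ) (ht : 0 ≤ t) :
    phi σ (2 * t) ≤ 2 * Real.exp (Real.log 2 / (σ - 1)) * phi σ t := by
  have hs : 0 < σ - 1 := by linarith
  rw [phi_eq hσ ht, phi_eq hσ (by linarith)]
  have : Real.exp (lambertW (2 * t) / (σ - 1)) ≤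
      Real.exp (Real.log 2 / (σ - 1)) * Real.exp (lambertW t / (σ - 1)) := by
    rw [← Real.exp_add, ← add_div, add_comm]
    gcongr
    exact lambertW_two_mul_le ht
  calc 2 * t * Real.exp (lambertW (2 * t) / (σ - 1))
      ≤ 2 * t * (Real.exp (Real.log 2 / (σ - 1)) * Real.exp (lambertW t / (σ - 1))) := by gcongr
    _ = _ := by ring

theorem phi_le_rpow {σ t : ℝ} (hσ : 1 < σ) (ht : Real.exp 1 ≤ t) :
    phi σ t ≤ t ^ (1 + 1 / (σ - 1)) := by
  have hs : 0 < σ - 1 := by linarith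
  have ht0 : 0 < t := (Real.exp_pos 1).trans_le ht
  rw [phi_eq hσ ht0.le, Real.rpow_add ht0, Real.rpow_one, Real.rpow_def_of_pos ht0, mul_one_div]
  gcongr
  exact lambertW_le_log ht

/-- The function `k ↦ φ_σ(ln₊ |k|)` is itself a weight function. -/
theorem isWeightFunction_phi {σ : ℝ} (hσ : 1 < σ) :
    IsWeightFunction (fun k => phi σ (Real.posLog |k|)) where
  nonneg t := phi_nonneg hσ Real.posLog_nonneg
  continuous := (continuousOn_phi hσ).comp_continuous
    (Real.continuous_posLog.comp continuous_abs) fun _ => Real.posLog_nonneg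
  even t := by simp
  monotoneOn a ha b hb hab := by
    refine phi_mono hσ Real.posLog_nonneg Real.posLog_nonneg ?_
    rw [abs_of_nonneg ha, abs_of_nonneg hb]
    exact Real.posLog_le_posLog ha hab
  map_zero := by simp [phi_zero]
  alpha := by
    refine IsBigO.of_bound (2 * Real.exp (Real.log 2 / (σ - 1))) ?_
    filter_upwards [eventually_ge_atTop 2] with t ht
    have h1 : Real.posLog |t| = Real.log t := by
      rw [Real.posLog_abs, Real.posLog_eq_log (by rw [abs_of_nonneg] <;> linarith)]
    have h2 : Real.posLog |2 * t| = Real.log 2 + Real.log t := by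
      rw [Real.posLog_abs, Real.posLog_eq_log (by rw [abs_of_nonneg] <;> linarith),
        Real.log_mul (by norm_num) (by linarith)]
    have h3 : 0 < Real.log 2 := Real.log_pos (by norm_num)
    have h4 : Real.log 2 ≤ Real.log t := Real.log_le_log (by norm_num) ht
    have h5 : 0 ≤ Real.log t := by linarith
    rw [h1, h2, Real.norm_of_nonneg (phi_nonneg hσ (by linarith)),
      Real.norm_of_nonneg (phi_nonneg hσ h5)]
    exact le_trans (phi_mono hσ (mem_Ici.2 (by linarith)) (mem_Ici.2 (by linarith)) (by linarith))
      (phi_two_mul_le hσ h5)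
  beta := by
    have h : (fun t : ℝ => Real.log t ^ (1 + 1 / (σ - 1))) =o[atTop] fun t : ℝ => t := by
      simpa using isLittleO_log_rpow_rpow_atTop (1 + 1 / (σ - 1)) (zero_lt_one (α := ℝ))
    refine IsBigO.trans (IsBigO.of_bound 1 ?_) h.isBigO
    filter_upwards [eventually_ge_atTop 1,
      Real.tendsto_log_atTop.eventually_ge_atTop (Real.exp 1)] with t ht hl
    have h1 : Real.posLog |t| = Real.log t := by
      rw [Real.posLog_abs, Real.posLog_eq_log (by rwa [abs_of_nonneg (by linarith)])]
    have h5 : 0 ≤ Real.log t := Real.log_nonneg ht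
    rw [h1, one_mul, Real.norm_of_nonneg (phi_nonneg hσ h5), Real.norm_of_nonneg (by positivity)]
    exact phi_le_rpow hσ hl
  gamma := by
    have hs : 0 < σ - 1 := by linarith
    have h : Tendsto (fun t => Real.exp (lambertW (Real.log t) / (σ - 1))) atTop atTop :=
      Real.tendsto_exp_atTop.comp ((tendsto_lambertW.comp Real.tendsto_log_atTop).atTop_div_const
        hs)
    refine IsLittleO.of_bound fun c hc => ?_
    filter_upwards [eventually_ge_atTop 1, h.eventually_ge_atTop c⁻¹] with t ht hl
    have h1 : Real.posLog |t| = Real.log t := by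
      rw [Real.posLog_abs, Real.posLog_eq_log (by rwa [abs_of_nonneg (by linarith)])]
    have h5 : 0 ≤ Real.log t := Real.log_nonneg ht
    rw [h1, Real.norm_of_nonneg h5, Real.norm_of_nonneg (phi_nonneg hσ h5), phi_eq hσ h5]
    have : 1 ≤ c * Real.exp (lambertW (Real.log t) / (σ - 1)) := by
      rwa [inv_le_iff_one_le_mul₀' hc] at hl
    nlinarith
  delta := by
    have e : (fun t : ℝ => phi σ (Real.posLog |Real.exp t|)) = fun t => phi σ (max 0 t) := by
      funext t
      rw [Real.posLog_abs, Real.posLog, Real.log_exp]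
    simp only [e]
    have hm : ConvexOn ℝ univ (fun t : ℝ => max 0 t) :=
      (convexOn_const 0 convex_univ).sup (convexOn_id convex_univ)
    have hi : (fun t : ℝ => max 0 t) '' univ ⊆ Ici 0 := by
      rintro _ ⟨t, -, rfl⟩
      exact le_max_left 0 t
    refine ⟨convex_univ, fun x _ y _ a b ha hb hab => ?_⟩
    have h := hm.2 (mem_univ x) (mem_univ y) ha hb hab
    refine (phi_mono hσ (hi (mem_image_of_mem _ (mem_univ _))) ?_ h).trans
      ((convexOn_phi hσ).2 (le_max_left 0 x) (le_max_left 0 y) ha hb hab)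
    exact (le_max_left 0 _).trans h

/-! ### The Young conjugate of `φ_σ` -/

theorem mul_sub_phi {σ t : ℝ} (hσ : 1 < σ) (ht : 0 ≤ t) (y : ℝ) :
    y * t - phi σ t = t * (y - Real.exp (lambertW t / (σ - 1))) := by
  rw [phi_eq hσ ht]; ring

theorem mul_sub_phi_le {σ t y : ℝ} (hσ : 1 < σ) (hy : 0 ≤ y) (ht : 0 ≤ t) :
    y * t - phi σ t ≤ (σ - 1) * y ^ σ * Real.posLog y := by
  have hs : 0 < σ - 1 := by linarith
  rw [mul_sub_phi hσ ht]
  have hl := Real.posLog_nonneg (x := y)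
  rcases le_or_gt y (Real.exp (lambertW t / (σ - 1))) with h | h
  · exact (mul_nonpos_of_nonneg_of_nonpos ht (by linarith)).trans (by positivity)
  · obtain ⟨hw, ht'⟩ := lambertW_spec ht
    have hy0 : 0 < y := (Real.exp_pos _).trans h
    have hw' : lambertW t ≤ Real.log y * (σ - 1) := by
      rw [← div_le_iff₀ hs]
      exact ((Real.lt_log_iff_exp_lt hy0).2 h).le
    have hly : 0 ≤ Real.log y := by
      have := hw.trans hw'
      nlinarith
    have he : Real.exp (lambertW t) ≤ y ^ (σ - 1) := by
      rw [Real.rpow_def_of_pos hy0]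
      exact Real.exp_le_exp.2 hw'
    have e : y ^ σ = y ^ (σ - 1) * y := by
      rw [← Real.rpow_add_one hy0.ne', sub_add_cancel]
    have hp : Real.posLog y = Real.log y := max_eq_right hly
    calc t * (y - Real.exp (lambertW t / (σ - 1)))
        ≤ t * y := by gcongr; linarith [Real.exp_pos (lambertW t / (σ - 1))]
      _ = lambertW t * Real.exp (lambertW t) * y := by rw [ht']
      _ ≤ Real.log y * (σ - 1) * y ^ (σ - 1) * y := by gcongr
      _ = (σ - 1) * y ^ σ * Real.posLog y := by rw [e, hp]; ring

theorem bddAbove_mul_sub_phi {σ y : ℝ} (hσ : 1 < σ) (hy : 0 ≤ y) :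
    BddAbove (range (fun t : Ioi (0 : ℝ) => y * t - phi σ t)) := by
  refine ⟨(σ - 1) * y ^ σ * Real.posLog y, ?_⟩
  rintro _ ⟨t, rfl⟩
  exact mul_sub_phi_le hσ hy (le_of_lt t.2)

theorem le_youngConj_phi {σ y t : ℝ} (hσ : 1 < σ) (hy : 0 ≤ y) (ht : 0 < t) :
    y * t - phi σ t ≤ youngConj (phi σ) y :=
  le_ciSup (bddAbove_mul_sub_phi hσ hy) ⟨t, ht⟩

theorem youngConj_le {φ : ℝ → ℝ} {y c : ℝ} (h : ∀ t, 0 < t → y * t - φ t ≤ c) :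
    youngConj φ y ≤ c :=
  have : Nonempty (Ioi (0 : ℝ)) := ⟨⟨1, mem_Ioi.2 one_pos⟩⟩
  ciSup_le fun t => h t t.2

theorem youngConj_phi_nonneg {σ y : ℝ} (hσ : 1 < σ) (hy : 0 ≤ y) :
    0 ≤ youngConj (phi σ) y := by
  have h : Tendsto (fun t => -phi σ t) (𝓝[>] 0) (𝓝 0) := by
    have h1 := ((continuousOn_phi hσ) 0 self_mem_Ici).mono Ioi_subset_Ici_self
    simpa [phi_zero] using h1.tendsto.neg
  refine le_of_tendsto h ?_
  filter_upwards [self_mem_nhdsWithin] with t ht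
  have ht : 0 < t := ht
  nlinarith [le_youngConj_phi hσ hy ht, mul_nonneg hy ht.le]

theorem youngConj_phi_le {σ y : ℝ} (hσ : 1 < σ) (hy : 0 ≤ y) :
    youngConj (phi σ) y ≤ (σ - 1) * y ^ σ * Real.posLog y :=
  youngConj_le fun _ ht => mul_sub_phi_le hσ hy ht.le

theorem youngConj_phi_zero {σ : ℝ} (hσ : 1 < σ) : youngConj (phi σ) 0 = 0 := by
  refine le_antisymm ?_ (youngConj_phi_nonneg hσ le_rfl)
  simpa using youngConj_phi_le hσ le_rfl

theorem le_youngConj_phi_of_pos {σ y : ℝ} (hσ : 1 < σ) (hy : 0 < y) :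
    (σ - 1) * (y / 2) ^ σ * Real.log (y / 2) ≤ youngConj (phi σ) y := by
  have hs : 0 < σ - 1 := by linarith
  rcases le_or_gt (Real.log (y / 2)) 0 with h | h
  · exact (mul_nonpos_of_nonneg_of_nonpos (by positivity) h).trans
      (youngConj_phi_nonneg hσ hy.le)
  · -- The supremum is nearly attained where `exp (W(t) / (σ - 1)) = y / 2`.
    set w := (σ - 1) * Real.log (y / 2) with hw
    have hw0 : 0 < w := mul_pos hs h
    have ht : 0 < w * Real.exp w := by positivity
    have hy2 : 0 < y / 2 := by linarith
    refine le_trans (le_of_eq ?_) (le_youngConj_phi hσ hy.le ht)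
    rw [mul_sub_phi hσ ht.le, lambertW_mul_exp hw0.le]
    have e1 : Real.exp (w / (σ - 1)) = y / 2 := by
      rw [hw, mul_div_cancel_left₀ _ hs.ne', Real.exp_log hy2]
    have e2 : (y / 2) ^ σ = Real.exp w * (y / 2) := by
      have : Real.exp w = (y / 2) ^ (σ - 1) := by
        rw [Real.rpow_def_of_pos hy2, hw, mul_comm]
      rw [this, ← Real.rpow_add_one hy2.ne', sub_add_cancel]
    rw [e1, e2, hw]
    ring

/-! ### The two weight matrices -/

theorem gevreySeq_eq {σ : ℝ} (hσ : 1 < σ) (τ : ℝ) (p : ℕ) :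
    gevreySeq σ τ p = Real.exp (τ * ((p : ℝ) ^ σ * Real.log p)) := by
  rcases p.eq_zero_or_pos with rfl | hp
  · simp [gevreySeq, Real.zero_rpow (by linarith : σ ≠ 0)]
  · rw [gevreySeq, Real.rpow_def_of_pos (by exact_mod_cast hp)]
    ring_nf

theorem gevreySeq_pos {σ : ℝ} (hσ : 1 < σ) (τ : ℝ) (p : ℕ) : 0 < gevreySeq σ τ p := by
  rw [gevreySeq_eq hσ]; exact Real.exp_pos _

theorem youngSeq_pos (σ H : ℝ) (p : ℕ) : 0 < youngSeq σ H p := Real.exp_pos _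

theorem gevreySeq_zero {σ : ℝ} (hσ : 1 < σ) (τ : ℝ) : gevreySeq σ τ 0 = 1 := by
  simp [gevreySeq_eq hσ]

theorem youngSeq_zero {σ : ℝ} (hσ : 1 < σ) (H : ℝ) : youngSeq σ H 0 = 1 := by
  simp [youngSeq, youngConj_phi_zero hσ]

theorem rpow_mul_log_natCast_nonneg (σ : ℝ) (p : ℕ) : 0 ≤ (p : ℝ) ^ σ * Real.log p := by
  have := Real.log_natCast_nonneg p
  positivity

/-- Midpoint convexity of `x ^ σ log x` at the natural numbers. It holds since `σ x ^ σ log x`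
is `u log u` for `u = x ^ σ`, and both `u ↦ u log u` and `x ↦ x ^ σ` are convex. -/
theorem two_mul_rpow_mul_log_le {σ : ℝ} (hσ : 1 < σ) (p : ℕ) :
    2 * (((p + 1 : ℕ) : ℝ) ^ σ * Real.log (p + 1 : ℕ)) ≤
      (p : ℝ) ^ σ * Real.log p + ((p + 2 : ℕ) : ℝ) ^ σ * Real.log (p + 2 : ℕ) := by
  have key : ∀ n : ℕ, (n : ℝ) ^ σ * Real.log ((n : ℝ) ^ σ) =
      σ * ((n : ℝ) ^ σ * Real.log n) := by
    intro n
    rcases n.eq_zero_or_pos with rfl | hn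
    · simp [Real.zero_rpow (by linarith : σ ≠ 0)]
    · rw [Real.log_rpow (by exact_mod_cast hn)]; ring
  set u : ℕ → ℝ := fun n => (n : ℝ) ^ σ with hu
  have hu0 : ∀ n, 0 ≤ u n := fun n => by positivity
  have hmid : u (p + 1) ≤ (1 / 2 : ℝ) * u p + (1 / 2 : ℝ) * u (p + 2) := by
    have h := (convexOn_rpow hσ.le).2 (mem_Ici.2 (p.cast_nonneg (α := ℝ)))
      (mem_Ici.2 ((p + 2).cast_nonneg (α := ℝ))) (by norm_num : (0 : ℝ) ≤ 1 / 2)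
      (by norm_num : (0 : ℝ) ≤ 1 / 2) (by norm_num)
    simp only [smul_eq_mul] at h
    have e : (1 / 2 : ℝ) * (p : ℝ) + 1 / 2 * ((p + 2 : ℕ) : ℝ) = ((p + 1 : ℕ) : ℝ) := by
      push_cast; ring
    rwa [e] at h
  have h1 : 1 ≤ u (p + 1) := Real.one_le_rpow (by push_cast; linarith [p.cast_nonneg (α := ℝ)])
    (by linarith)
  have hconv := Real.convexOn_mul_log.2 (mem_Ici.2 (hu0 p)) (mem_Ici.2 (hu0 (p + 2)))
    (by norm_num : (0 : ℝ) ≤ 1 / 2) (by norm_num : (0 : ℝ) ≤ 1 / 2) (by norm_num)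
  simp only [smul_eq_mul] at hconv
  have hmono : u (p + 1) * Real.log (u (p + 1)) ≤
      (1 / 2 * u p + 1 / 2 * u (p + 2)) * Real.log (1 / 2 * u p + 1 / 2 * u (p + 2)) :=
    mul_le_mul hmid (Real.log_le_log (by linarith) hmid) (Real.log_nonneg h1) (by linarith)
  have h2 := hmono.trans hconv
  simp only [hu] at h2
  rw [key, key, key] at h2
  have hσ0 : 0 < σ := by linarith
  refine le_of_mul_le_mul_left ?_ hσ0
  linarith

theorem isWeightSequence_gevreySeq {σ τ : ℝ} (hσ : 1 < σ) (hτ : 0 < τ) :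
    IsWeightSequence (gevreySeq σ τ) where
  pos := gevreySeq_pos hσ τ
  zero := gevreySeq_zero hσ τ
  one := by simp [gevreySeq_eq hσ]
  logConvex p := by
    rw [gevreySeq_eq hσ, gevreySeq_eq hσ, gevreySeq_eq hσ, ← Real.exp_nat_mul, ← Real.exp_add]
    refine Real.exp_le_exp.2 ?_
    have := mul_le_mul_of_nonneg_left (two_mul_rpow_mul_log_le hσ p) hτ.le
    rw [Nat.cast_ofNat]
    linarith
  root := by
    have hs : 0 < σ - 1 := by linarith
    have hc : Tendsto (fun p : ℕ => (p : ℝ)) atTop atTop := tendsto_natCast_atTop_atTop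
    have h : Tendsto (fun p : ℕ => τ * ((p : ℝ) ^ (σ - 1) * Real.log p)) atTop atTop :=
      (((tendsto_rpow_atTop hs).comp hc).atTop_mul_atTop₀
        (Real.tendsto_log_atTop.comp hc)).const_mul_atTop hτ
    refine (Real.tendsto_exp_atTop.comp h).congr' ?_
    filter_upwards [eventually_gt_atTop 0] with p hp
    have hp' : (0 : ℝ) < p := by exact_mod_cast hp
    rw [gevreySeq_eq hσ, ← Real.exp_mul, Function.comp_apply, Real.rpow_sub_one hp'.ne']
    congr 1
    ring

theorem isWeightSequence_youngSeq {σ H : ℝ} (hσ : 1 < σ) (hH : 0 < H) :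
    IsWeightSequence (youngSeq σ H) where
  pos := youngSeq_pos σ H
  zero := youngSeq_zero hσ H
  one := by
    have := youngConj_phi_nonneg (y := H * (1 : ℕ)) hσ (by positivity)
    exact Real.one_le_exp (by positivity)
  logConvex p := by
    simp only [youngSeq]
    rw [← Real.exp_nat_mul, ← Real.exp_add]
    refine Real.exp_le_exp.2 ?_
    have h : youngConj (phi σ) (H * (p + 1 : ℕ)) ≤ (youngConj (phi σ) (H * p) +
        youngConj (phi σ) (H * (p + 2 : ℕ))) / 2 := by
      refine youngConj_le fun t ht => ?_
      have h1 := le_youngConj_phi (y := H * p) hσ (by positivity) ht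
      have h2 := le_youngConj_phi (y := H * (p + 2 : ℕ)) hσ (by positivity) ht
      push_cast at h1 h2 ⊢
      linarith
    have h' := mul_le_mul_of_nonneg_left h (by positivity : 0 ≤ 1 / H)
    rw [Nat.cast_ofNat]
    linarith
  root := by
    have h : Tendsto (fun p : ℕ => youngConj (phi σ) (H * p) / (H * p)) atTop atTop := by
      refine tendsto_atTop.2 fun b => ?_
      have hc : Tendsto (fun p : ℕ => H * (p : ℝ)) atTop atTop :=
        tendsto_natCast_atTop_atTop.const_mul_atTop hH
      filter_upwards [eventually_gt_atTop 0,
        hc.eventually_ge_atTop (phi σ (|b| + 1))] with p hp hle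
      have hp' : (0 : ℝ) < H * p := mul_pos hH (by exact_mod_cast hp)
      rw [le_div_iff₀ hp']
      have h1 := le_youngConj_phi (t := |b| + 1) hσ hp'.le (by positivity)
      nlinarith [le_abs_self b]
    refine (Real.tendsto_exp_atTop.comp h).congr fun p => ?_
    rw [youngSeq, ← Real.exp_mul, Function.comp_apply]
    congr 1
    field_simp

theorem isWeightMatrix_gevreyMatrix {σ : ℝ} (hσ : 1 < σ) : IsWeightMatrix (gevreyMatrix σ) := by
  have mono : ∀ {τ τ' : ℝ}, τ ≤ τ' → ∀ p, gevreySeq σ τ p ≤ gevreySeq σ τ' p := by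
    intro τ τ' h p
    rw [gevreySeq_eq hσ, gevreySeq_eq hσ]
    exact Real.exp_le_exp.2 (mul_le_mul_of_nonneg_right h (rpow_mul_log_natCast_nonneg σ p))
  constructor
  · rintro _ ⟨τ, hτ, rfl⟩
    exact isWeightSequence_gevreySeq hσ hτ
  · rintro _ ⟨τ, -, rfl⟩ _ ⟨τ', -, rfl⟩
    exact (le_total τ τ').imp mono mono

theorem isWeightMatrix_youngMatrix {σ : ℝ} (hσ : 1 < σ) : IsWeightMatrix (youngMatrix σ) := by
  have mono : ∀ {H H' : ℝ}, 0 < H → H ≤ H' → ∀ p, youngSeq σ H p ≤ youngSeq σ H' p := by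
    intro H H' hH h p
    have hH' : 0 < H' := hH.trans_le h
    refine Real.exp_le_exp.2 ?_
    rw [one_div_mul_eq_div, div_le_iff₀ hH]
    refine youngConj_le fun t ht => ?_
    have h1 := le_youngConj_phi (y := H' * p) hσ (by positivity) ht
    have h2 : H / H' ≤ 1 := (div_le_one hH').2 h
    have h3 := phi_nonneg hσ ht.le
    calc H * p * t - phi σ t ≤ H / H' * (H' * p * t - phi σ t) := by
          have : H / H' * (H' * p * t - phi σ t) = H * p * t - H / H' * phi σ t := by
            field_simp
          rw [this]
          nlinarith
      _ ≤ H / H' * youngConj (phi σ) (H' * p) := by gcongr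
      _ = 1 / H' * youngConj (phi σ) (H' * p) * H := by ring
  constructor
  · rintro _ ⟨H, hH, rfl⟩
    exact isWeightSequence_youngSeq hσ hH
  · rintro _ ⟨H, hH, rfl⟩ _ ⟨H', hH', rfl⟩
    exact (le_total H H').imp (mono hH) (mono hH')

/-! ### Comparison of the two matrices -/

/-- `M ≤ C N` pointwise, for some constant `C > 0`. -/
def Dominated (M N : ℕ → ℝ) : Prop := ∃ C : ℝ, 0 < C ∧ ∀ p, M p ≤ C * N p

theorem Dominated.of_le {M N : ℕ → ℝ} (h : ∀ p, M p ≤ N p) : Dominated M N :=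
  ⟨1, one_pos, by simpa using h⟩

theorem Dominated.of_eventually_le {M N : ℕ → ℝ} (hM : ∀ p, 0 < M p) (hN : ∀ p, 0 < N p)
    (h : ∀ᶠ p in atTop, M p ≤ N p) : Dominated M N := by
  obtain ⟨P, hP⟩ := eventually_atTop.1 h
  have hr : ∀ i, 0 ≤ M i / N i := fun i => (div_pos (hM i) (hN i)).le
  have hS : 0 ≤ ∑ i ∈ Finset.range P, M i / N i := Finset.sum_nonneg fun i _ => hr i
  refine ⟨1 + ∑ i ∈ Finset.range P, M i / N i, by linarith, fun p => ?_⟩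
  rw [← div_le_iff₀ (hN p)]
  rcases lt_or_ge p P with hp | hp
  · have := Finset.single_le_sum (fun i _ => hr i) (Finset.mem_range.2 hp)
    linarith
  · have := (div_le_one (hN p)).2 (hP p hp)
    linarith

/-- For normalized sequences, a constant factor can be absorbed into a geometric one. -/
theorem Dominated.exists_pow_mul {M N : ℕ → ℝ} (h : Dominated M N) (hM : M 0 = 1) (hN : N 0 = 1)
    (hN0 : ∀ p, 0 < N p) : ∃ C : ℝ, 0 < C ∧ ∀ p, M p ≤ C ^ p * N p := by
  obtain ⟨C, -, hMN⟩ := h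
  refine ⟨max 1 C, by positivity, fun p => ?_⟩
  rcases p.eq_zero_or_pos with rfl | hp
  · simp [hM, hN]
  · refine (hMN p).trans (mul_le_mul_of_nonneg_right ?_ (hN0 p).le)
    exact (le_max_right 1 C).trans (le_self_pow₀ (le_max_left 1 C) hp.ne')

theorem youngSeq_le {σ H : ℝ} (hσ : 1 < σ) (hH : 0 < H) (p : ℕ) :
    youngSeq σ H p ≤
      Real.exp ((σ - 1) * H ^ (σ - 1) * ((p : ℝ) ^ σ * Real.posLog (H * p))) := by
  refine Real.exp_le_exp.2 ?_
  have h := mul_le_mul_of_nonneg_left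
    (youngConj_phi_le (y := H * p) hσ (by positivity)) (by positivity : 0 ≤ 1 / H)
  refine h.trans (le_of_eq ?_)
  rw [Real.mul_rpow hH.le (by positivity), Real.rpow_sub_one hH.ne']
  ring

theorem le_youngSeq {σ H : ℝ} (hσ : 1 < σ) (hH : 0 < H) {p : ℕ} (hp : 0 < p) :
    Real.exp ((σ - 1) * H ^ (σ - 1) / 2 ^ σ * ((p : ℝ) ^ σ * Real.log (H * p / 2))) ≤
      youngSeq σ H p := by
  have hp' : (0 : ℝ) < p := by exact_mod_cast hp
  refine Real.exp_le_exp.2 ?_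
  have h := mul_le_mul_of_nonneg_left
    (le_youngConj_phi_of_pos (y := H * p) hσ (by positivity)) (by positivity : 0 ≤ 1 / H)
  refine le_trans (le_of_eq ?_) h
  rw [Real.div_rpow (by positivity) (by norm_num), Real.mul_rpow hH.le hp'.le,
    Real.rpow_sub_one hH.ne']
  ring

theorem exists_pos_le_rpow_le {s a b : ℝ} (hs : 0 < s) (ha : 0 < a) (hb : 0 < b) :
    ∃ δ > 0, δ ≤ a ∧ δ ^ s ≤ b := by
  refine ⟨min a (b ^ s⁻¹), by positivity, min_le_left _ _, ?_⟩
  refine (Real.rpow_le_rpow (by positivity) (min_le_right _ _) hs.le).trans (le_of_eq ?_)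
  rw [← Real.rpow_mul hb.le, inv_mul_cancel₀ hs.ne', Real.rpow_one]

theorem tendsto_log_natCast : Tendsto (fun p : ℕ => Real.log p) atTop atTop :=
  Real.tendsto_log_atTop.comp tendsto_natCast_atTop_atTop

theorem exists_gevreySeq_dominated_large {σ τ : ℝ} (hσ : 1 < σ) :
    ∃ H > 0, Dominated (gevreySeq σ τ) (youngSeq σ H) := by
  have hs : 0 < σ - 1 := by linarith
  obtain ⟨H, hH2, hH⟩ := ((eventually_ge_atTop (2 : ℝ)).and
    ((tendsto_rpow_atTop hs).eventually_ge_atTop (τ * 2 ^ σ / (σ - 1)))).exists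
  have hH0 : 0 < H := by linarith
  refine ⟨H, hH0, .of_le fun p => ?_⟩
  rcases p.eq_zero_or_pos with rfl | hp
  · rw [gevreySeq_zero hσ, youngSeq_zero hσ]
  have hp' : (1 : ℝ) ≤ p := by exact_mod_cast hp
  refine le_trans ?_ (le_youngSeq hσ hH0 hp)
  rw [gevreySeq_eq hσ]
  refine Real.exp_le_exp.2 ?_
  have h1 : τ ≤ (σ - 1) * H ^ (σ - 1) / 2 ^ σ := by
    rw [le_div_iff₀ (by positivity)]
    rwa [div_le_iff₀' hs] at hH
  have h2 : Real.log p ≤ Real.log (H * p / 2) := Real.log_le_log (by linarith) (by nlinarith)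
  exact mul_le_mul h1 (by gcongr) (rpow_mul_log_natCast_nonneg σ p) (by positivity)

theorem exists_youngSeq_dominated_large {σ H : ℝ} (hσ : 1 < σ) (hH : 0 < H) :
    ∃ τ > 0, Dominated (youngSeq σ H) (gevreySeq σ τ) := by
  have hs : 0 < σ - 1 := by linarith
  refine ⟨(σ - 1) * H ^ (σ - 1) * 2, by positivity,
    .of_eventually_le (youngSeq_pos σ H) (gevreySeq_pos hσ _) ?_⟩
  filter_upwards [eventually_gt_atTop 0, tendsto_log_natCast.eventually_ge_atTop (Real.log H)]
    with p hp hl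
  have hp' : (0 : ℝ) < p := by exact_mod_cast hp
  refine (youngSeq_le hσ hH p).trans ?_
  rw [gevreySeq_eq hσ]
  refine Real.exp_le_exp.2 ?_
  rw [mul_assoc _ (2 : ℝ), mul_left_comm (2 : ℝ)]
  gcongr
  refine max_le (mul_nonneg (by norm_num) (Real.log_natCast_nonneg p)) ?_
  rw [Real.log_mul hH.ne' hp'.ne']
  linarith

theorem exists_youngSeq_dominated_small {σ τ : ℝ} (hσ : 1 < σ) (hτ : 0 < τ) :
    ∃ H > 0, Dominated (youngSeq σ H) (gevreySeq σ τ) := by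
  have hs : 0 < σ - 1 := by linarith
  obtain ⟨H, hH, hH1, hHs⟩ := exists_pos_le_rpow_le hs one_pos (div_pos hτ hs)
  refine ⟨H, hH, .of_le fun p => (youngSeq_le hσ hH p).trans ?_⟩
  rw [gevreySeq_eq hσ]
  refine Real.exp_le_exp.2 ?_
  have h1 : (σ - 1) * H ^ (σ - 1) ≤ τ := by rwa [le_div_iff₀' hs] at hHs
  have h2 : Real.posLog (H * p) ≤ Real.log p := by
    refine (Real.posLog_le_posLog (by positivity)
      (mul_le_of_le_one_left (Nat.cast_nonneg p) hH1)).trans (le_of_eq ?_)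
    exact max_eq_right (Real.log_natCast_nonneg p)
  have h3 := Real.posLog_nonneg (x := H * p)
  gcongr

theorem exists_gevreySeq_dominated_small {σ H : ℝ} (hσ : 1 < σ) (hH : 0 < H) :
    ∃ τ > 0, Dominated (gevreySeq σ τ) (youngSeq σ H) := by
  have hs : 0 < σ - 1 := by linarith
  refine ⟨(σ - 1) * H ^ (σ - 1) / 2 ^ σ * (1 / 2), by positivity,
    .of_eventually_le (gevreySeq_pos hσ _) (youngSeq_pos σ H) ?_⟩
  filter_upwards [eventually_gt_atTop 0,
    tendsto_log_natCast.eventually_ge_atTop (-2 * Real.log (H / 2))] with p hp hl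
  have hp' : (0 : ℝ) < p := by exact_mod_cast hp
  refine le_trans ?_ (le_youngSeq hσ hH hp)
  rw [gevreySeq_eq hσ]
  refine Real.exp_le_exp.2 ?_
  rw [mul_assoc _ (1 / 2 : ℝ), mul_left_comm (1 / 2 : ℝ)]
  gcongr
  rw [mul_div_right_comm, Real.log_mul (by positivity) hp'.ne']
  linarith

theorem matrixEquiv_gevreyMatrix_youngMatrix {σ : ℝ} (hσ : 1 < σ) :
    MatrixEquiv (gevreyMatrix σ) (youngMatrix σ) := by
  constructor
  · rintro _ ⟨τ, -, rfl⟩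
    obtain ⟨H, hH, h⟩ := exists_gevreySeq_dominated_large (τ := τ) hσ
    exact ⟨_, ⟨H, hH, rfl⟩,
      h.exists_pow_mul (gevreySeq_zero hσ τ) (youngSeq_zero hσ H) (youngSeq_pos σ H)⟩
  · rintro _ ⟨H, hH, rfl⟩
    obtain ⟨τ, hτ, h⟩ := exists_youngSeq_dominated_large hσ hH
    exact ⟨_, ⟨τ, hτ, rfl⟩,
      h.exists_pow_mul (youngSeq_zero hσ H) (gevreySeq_zero hσ τ) (gevreySeq_pos hσ τ)⟩

/-! ### The associated functions -/

theorem assocTerm_eq {σ τ h k : ℝ} (hσ : 1 < σ) (hτ : 0 < τ) (hh : 0 < h) (hk : 0 < k) (p : ℕ) :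
    assocTerm σ τ h k p = max 0
      (p * Real.log k - τ * ((p : ℝ) ^ σ * (Real.log p - Real.log h / τ))) := by
  rw [assocTerm, Real.posLog, gevreySeq_eq hσ, Real.log_div (by positivity) (Real.exp_ne_zero _),
    Real.log_mul (by positivity) (by positivity), Real.log_rpow hh, Real.log_pow, Real.log_exp]
  congr 1
  field_simp
  ring

/-- Let `w = W(ln₊ k)`. The terms with `p ≤ C exp (w / (σ - 1))` are at most
`p ln₊ k ≤ C φ_σ(ln₊ k)`, up to an additive constant which accounts for the factor `h ^ p ^ σ`,
and the remaining terms vanish when `C` is large. -/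
theorem exists_assocTerm_le {σ τ h : ℝ} (hσ : 1 < σ) (hτ : 0 < τ) (hh : 0 < h) :
    ∃ C > 0, ∃ D ≥ 0, ∀ k > 0, ∀ p : ℕ,
      assocTerm σ τ h k p ≤ C * phi σ (Real.posLog k) + D := by
  have hs : 0 < σ - 1 := by linarith
  set b := Real.log h / τ with hb
  obtain ⟨C, hC1, hC2⟩ := ((eventually_ge_atTop (Real.exp b)).and
    ((tendsto_rpow_atTop hs).eventually_ge_atTop ((σ - 1) / τ))).exists
  have hC : 0 < C := (Real.exp_pos b).trans_le hC1
  refine ⟨C, hC, τ * (Real.exp b ^ σ * |b|), by positivity, fun k hk p => ?_⟩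
  set x := Real.posLog k
  have hx : 0 ≤ x := Real.posLog_nonneg
  have hφ := phi_nonneg hσ hx
  have hD : 0 ≤ τ * (Real.exp b ^ σ * |b|) := by positivity
  rw [assocTerm_eq hσ hτ hh hk, ← hb]
  refine max_le (by positivity) ?_
  rcases p.eq_zero_or_pos with rfl | hp
  · have : σ ≠ 0 := by linarith
    simp only [Nat.cast_zero, Real.zero_rpow this, zero_mul, mul_zero, sub_zero]
    positivity
  have hp' : (0 : ℝ) < p := by exact_mod_cast hp
  have hkx : p * Real.log k ≤ p * x := by
    gcongr
    exact le_max_right 0 _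
  obtain ⟨hw, hwx⟩ := lambertW_spec hx
  rw [phi_eq hσ hx] at hφ ⊢
  set w := lambertW x
  rcases le_or_gt (p : ℝ) (C * Real.exp (w / (σ - 1))) with hle | hlt
  · have h1 : (p : ℝ) * x ≤ C * (x * Real.exp (w / (σ - 1))) := by
      nlinarith
    have h2 : -(τ * ((p : ℝ) ^ σ * (Real.log p - b))) ≤ τ * (Real.exp b ^ σ * |b|) := by
      rw [← mul_neg, ← mul_neg]
      refine mul_le_mul_of_nonneg_left ?_ hτ.le
      have hl := Real.log_natCast_nonneg p
      rcases le_or_gt b (Real.log p) with hbl | hbl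
      · exact (mul_nonpos_of_nonneg_of_nonpos (by positivity) (by linarith)).trans (by positivity)
      · have : (p : ℝ) ≤ Real.exp b := ((Real.log_lt_iff_lt_exp hp').1 hbl).le
        have hb' := le_abs_self b
        refine mul_le_mul (Real.rpow_le_rpow hp'.le this (by linarith)) ?_ ?_ (by positivity) <;>
          linarith
    linarith
  · have hl : w / (σ - 1) ≤ Real.log p - b := by
      have h1 := Real.log_le_log (by positivity) hlt.le
      rw [Real.log_mul hC.ne' (Real.exp_ne_zero _), Real.log_exp] at h1
      have := (Real.le_log_iff_exp_le hC).2 hC1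
      linarith
    have hpow : (σ - 1) / τ * Real.exp w ≤ (p : ℝ) ^ (σ - 1) := by
      have h1 := Real.rpow_le_rpow (by positivity) hlt.le hs.le
      rw [Real.mul_rpow hC.le (Real.exp_pos _).le, ← Real.exp_mul, div_mul_cancel₀ _ hs.ne'] at h1
      exact (mul_le_mul_of_nonneg_right hC2 (Real.exp_pos w).le).trans h1
    have hx' : x ≤ τ * ((p : ℝ) ^ (σ - 1) * (Real.log p - b)) := by
      have h1 : (σ - 1) / τ * Real.exp w * (w / (σ - 1)) ≤
          (p : ℝ) ^ (σ - 1) * (Real.log p - b) :=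
        mul_le_mul hpow hl (by positivity) (by positivity)
      have h2 : τ * ((σ - 1) / τ * Real.exp w * (w / (σ - 1))) = x := by
        rw [← hwx]
        field_simp
      rw [← h2]
      gcongr
    have e : (p : ℝ) ^ σ = (p : ℝ) ^ (σ - 1) * p := by
      rw [← Real.rpow_add_one hp'.ne', sub_add_cancel]
    have h3 := mul_le_mul_of_nonneg_left hx' hp'.le
    have h4 : τ * ((p : ℝ) ^ σ * (Real.log p - b)) =
        p * (τ * ((p : ℝ) ^ (σ - 1) * (Real.log p - b))) := by rw [e]; ring
    nlinarith

theorem bddAbove_assocTerm {σ τ h k : ℝ} (hσ : 1 < σ) (hτ : 0 < τ) (hh : 0 < h) (hk : 0 < k) :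
    BddAbove (range (assocTerm σ τ h k)) := by
  obtain ⟨C, -, D, -, hCD⟩ := exists_assocTerm_le hσ hτ hh
  refine ⟨C * phi σ (Real.posLog k) + D, ?_⟩
  rintro _ ⟨p, rfl⟩
  exact hCD k hk p

theorem assocFun_nonneg (σ τ h k : ℝ) : 0 ≤ assocFun σ τ h k :=
  Real.iSup_nonneg fun _ => Real.posLog_nonneg

/-- With `w = W(log k)`, the term of index `p = ⌊δ exp (w / (σ - 1))⌋` is at least
`p (log k) / 2` when `δ` is small, and this is comparable to `φ_σ(log k)`. -/
theorem exists_le_assocFun {σ τ h : ℝ} (hσ : 1 < σ) (hτ : 0 < τ) (hh : 0 < h) :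
    ∃ c > 0, ∀ᶠ k in atTop, c * phi σ (Real.log k) ≤ assocFun σ τ h k := by
  have hs : 0 < σ - 1 := by linarith
  set b := Real.log h / τ with hb
  obtain ⟨δ, hδ, hδ1, hδ2⟩ := exists_pos_le_rpow_le hs (Real.exp_pos b)
    (by positivity : 0 < (σ - 1) / (2 * τ))
  refine ⟨δ / 4, by positivity, ?_⟩
  have ht : Tendsto (fun k => Real.exp (lambertW (Real.log k) / (σ - 1))) atTop atTop :=
    Real.tendsto_exp_atTop.comp
      ((tendsto_lambertW.comp Real.tendsto_log_atTop).atTop_div_const hs)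
  filter_upwards [eventually_ge_atTop 1, ht.eventually_ge_atTop δ⁻¹] with k hk hE
  have hk0 : 0 < k := by linarith
  have hx : 0 ≤ Real.log k := Real.log_nonneg hk
  refine le_trans ?_ (le_ciSup (bddAbove_assocTerm hσ hτ hh hk0)
    ⌊δ * Real.exp (lambertW (Real.log k) / (σ - 1))⌋₊)
  rw [assocTerm_eq hσ hτ hh hk0, ← hb, phi_eq hσ hx]
  refine le_max_of_le_right ?_
  obtain ⟨hw, hwx⟩ := lambertW_spec hx
  set x := Real.log k
  set w := lambertW x
  set E := Real.exp (w / (σ - 1))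
  have hδE : 1 ≤ δ * E := by
    rwa [inv_le_iff_one_le_mul₀' hδ] at hE
  set p := ⌊δ * E⌋₊
  have hp : 0 < p := Nat.floor_pos.2 hδE
  have hp1 : (1 : ℝ) ≤ p := by exact_mod_cast hp
  have hp' : (0 : ℝ) < p := by linarith
  have hple : (p : ℝ) ≤ δ * E := Nat.floor_le (by positivity)
  have hlt : δ * E < p + 1 := Nat.lt_floor_add_one _
  have hl : Real.log p - b ≤ w / (σ - 1) := by
    have h1 := Real.log_le_log hp' hple
    rw [Real.log_mul hδ.ne' (Real.exp_ne_zero _), Real.log_exp] at h1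
    have := (Real.log_le_iff_le_exp hδ).2 hδ1
    linarith
  have hpow : (p : ℝ) ^ (σ - 1) ≤ (σ - 1) / (2 * τ) * Real.exp w := by
    have h1 := Real.rpow_le_rpow hp'.le hple hs.le
    rw [Real.mul_rpow hδ.le (Real.exp_pos _).le, ← Real.exp_mul,
      div_mul_cancel₀ _ hs.ne'] at h1
    exact h1.trans (mul_le_mul_of_nonneg_right hδ2 (Real.exp_pos w).le)
  have hhalf : τ * ((p : ℝ) ^ (σ - 1) * (Real.log p - b)) ≤ x / 2 := by
    calc τ * ((p : ℝ) ^ (σ - 1) * (Real.log p - b))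
        ≤ τ * ((p : ℝ) ^ (σ - 1) * (w / (σ - 1))) := by gcongr
      _ ≤ τ * ((σ - 1) / (2 * τ) * Real.exp w * (w / (σ - 1))) := by gcongr
      _ = x / 2 := by
        rw [← hwx]
        field_simp
  have e : (p : ℝ) ^ σ = (p : ℝ) ^ (σ - 1) * p := by
    rw [← Real.rpow_add_one hp'.ne', sub_add_cancel]
  have h3 := mul_le_mul_of_nonneg_left hhalf hp'.le
  have h4 : τ * ((p : ℝ) ^ σ * (Real.log p - b)) =
      p * (τ * ((p : ℝ) ^ (σ - 1) * (Real.log p - b))) := by rw [e]; ring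
  have h5 : x * (δ * E) ≤ x * (2 * p) := mul_le_mul_of_nonneg_left (by linarith) hx
  linarith

theorem equivalentToWeight_assocFun {σ τ h : ℝ} (hσ : 1 < σ) (hτ : 0 < τ) (hh : 0 < h) :
    EquivalentToWeight (fun k => assocFun σ τ h |k|) := by
  have hω := isWeightFunction_phi hσ
  refine ⟨_, hω, ?_, ?_⟩
  · obtain ⟨C, hC, D, hD, hCD⟩ := exists_assocTerm_le hσ hτ hh
    -- The additive constant `D` is absorbed, as `log k = o(φ_σ(log k))`.
    have hlog := hω.gamma.bound one_pos
    refine IsBigO.of_bound (C + D) ?_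
    filter_upwards [hlog, eventually_gt_atTop 0,
      Real.tendsto_log_atTop.eventually_ge_atTop 1] with k hk hk0 hk1
    rw [one_mul, Real.norm_of_nonneg (hω.nonneg k), Real.norm_of_nonneg (by linarith)] at hk
    rw [Real.norm_of_nonneg (hω.nonneg k), Real.norm_of_nonneg (assocFun_nonneg _ _ _ _)]
    refine ciSup_le fun p => (hCD |k| (abs_pos.2 hk0.ne') p).trans ?_
    nlinarith
  · obtain ⟨c, hc, hle⟩ := exists_le_assocFun hσ hτ hh
    refine IsBigO.of_bound c⁻¹ ?_
    filter_upwards [hle, eventually_ge_atTop 1] with k hk hk1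
    have e : |k| = k := abs_of_nonneg (by linarith)
    rw [Real.norm_of_nonneg (hω.nonneg k), Real.norm_of_nonneg (assocFun_nonneg _ _ _ _), e,
      Real.posLog_eq_log (by rwa [e]), le_inv_mul_iff₀ hc]
    exact hk

/-! ### Limits of equivalent families of spaces -/

variable {d : ℕ}

theorem TopSubspace.ext_of_continuous {V : Type*} [AddCommGroup V] [Module ℂ V]
    {X Y : TopSubspace V} (h : X.carrier = Y.carrier)
    (h1 : @Continuous _ _ X.topology Y.topology (Submodule.inclusion h.le))
    (h2 : @Continuous _ _ Y.topology X.topology (Submodule.inclusion h.ge)) : X = Y := by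
  obtain ⟨S, t⟩ := X
  obtain ⟨S', t'⟩ := Y
  obtain rfl : S = S' := h
  congr 1
  exact le_antisymm (continuous_id_iff_le.1 h1) (continuous_id_iff_le.1 h2)

/-- If every `S i` embeds continuously into some `S' j`, then the inductive limit of the `S i`
embeds continuously into that of the `S' j`. -/
theorem continuous_inclusion_inductiveLimit {ι κ V : Type*} [AddCommGroup V] [Module ℂ V]
    {S : ι → Submodule ℂ V} {t : ∀ i, TopologicalSpace (S i)}
    {S' : κ → Submodule ℂ V} {t' : ∀ i, TopologicalSpace (S' i)}
    (h : ∀ i, ∃ j, ∃ hle : S i ≤ S' j, @Continuous _ _ (t i) (t' j) (Submodule.inclusion hle))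
    (hle : (inductiveLimit S t).carrier ≤ (inductiveLimit S' t').carrier) :
    @Continuous _ _ (inductiveLimit S t).topology (inductiveLimit S' t').topology
      (Submodule.inclusion hle) := by
  -- A locally convex topology on the target that makes all `S' j` embed continuously pulls back
  -- to one on the source that makes all `S i` embed continuously.
  refine continuous_sInf_rng.2 fun T hT => continuous_iff_le_induced.2 (sInf_le ?_)
  obtain ⟨h1, h2, h3, h4⟩ := hT
  let _ : TopologicalSpace (inductiveLimit S' t').carrier := T
  have _ : IsTopologicalAddGroup (inductiveLimit S' t').carrier := h1
  have _ : ContinuousSMul ℂ (inductiveLimit S' t').carrier := h2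
  have _ : LocallyConvexSpace ℝ (inductiveLimit S' t').carrier := h3
  refine ⟨topologicalAddGroup_induced (Submodule.inclusion hle),
    continuousSMul_induced (Submodule.inclusion hle),
    LocallyConvexSpace.induced ((Submodule.inclusion hle).restrictScalars ℝ), fun i => ?_⟩
  obtain ⟨j, hj, hc⟩ := h i
  refine continuous_induced_rng.2 ?_
  exact @Continuous.comp _ _ _ (t i) (t' j) T _ _ (h4 j) hc

theorem inductiveLimit_eq {ι κ V : Type*} [AddCommGroup V] [Module ℂ V]
    {S : ι → Submodule ℂ V} {t : ∀ i, TopologicalSpace (S i)}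
    {S' : κ → Submodule ℂ V} {t' : ∀ i, TopologicalSpace (S' i)}
    (h : ∀ i, ∃ j, ∃ hle : S i ≤ S' j, @Continuous _ _ (t i) (t' j) (Submodule.inclusion hle))
    (h' : ∀ j, ∃ i, ∃ hle : S' j ≤ S i, @Continuous _ _ (t' j) (t i) (Submodule.inclusion hle)) :
    inductiveLimit S t = inductiveLimit S' t' := by
  have hle : (⨆ i, S i) ≤ ⨆ j, S' j := iSup_mono' fun i => (h i).imp fun _ hj => hj.1
  have hge : (⨆ j, S' j) ≤ ⨆ i, S i := iSup_mono' fun j => (h' j).imp fun _ hi => hi.1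
  exact TopSubspace.ext_of_continuous (le_antisymm hle hge)
    (continuous_inclusion_inductiveLimit h _) (continuous_inclusion_inductiveLimit h' _)

theorem continuous_inclusion_projectiveLimit {ι κ V : Type*} [AddCommGroup V] [Module ℂ V]
    {X : ι → TopSubspace V} {Y : κ → TopSubspace V}
    (h : ∀ j, ∃ i, ∃ hle : (X i).carrier ≤ (Y j).carrier,
      @Continuous _ _ (X i).topology (Y j).topology (Submodule.inclusion hle))
    (hle : (projectiveLimit (fun _ => LinearMap.id) X).carrier ≤
      (projectiveLimit (fun _ => LinearMap.id) Y).carrier) :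
    @Continuous _ _ (projectiveLimit (fun _ => LinearMap.id) X).topology
      (projectiveLimit (fun _ => LinearMap.id) Y).topology (Submodule.inclusion hle) := by
  refine continuous_iInf_rng.2 fun j => continuous_induced_rng.2 ?_
  obtain ⟨i, hi, hc⟩ := h j
  refine continuous_iInf_dom (i := i) ?_
  have hi' : (projectiveLimit (fun _ => LinearMap.id) X).carrier ≤ (X i).carrier :=
    iInf_le (fun i => (X i).carrier.comap LinearMap.id) i
  exact @Continuous.comp _ _ _ (.induced (Submodule.inclusion hi') (X i).topology)
    (X i).topology (Y j).topology _ _ hc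
    (@continuous_induced_dom _ _ (Submodule.inclusion hi') (X i).topology)

theorem projectiveLimit_eq {ι κ V : Type*} [AddCommGroup V] [Module ℂ V]
    {X : ι → TopSubspace V} {Y : κ → TopSubspace V}
    (h : ∀ j, ∃ i, ∃ hle : (X i).carrier ≤ (Y j).carrier,
      @Continuous _ _ (X i).topology (Y j).topology (Submodule.inclusion hle))
    (h' : ∀ i, ∃ j, ∃ hle : (Y j).carrier ≤ (X i).carrier,
      @Continuous _ _ (Y j).topology (X i).topology (Submodule.inclusion hle)) :
    projectiveLimit (fun _ => LinearMap.id) X = projectiveLimit (fun _ => LinearMap.id) Y := by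
  have hle : (⨅ i, (X i).carrier.comap LinearMap.id) ≤ ⨅ j, (Y j).carrier.comap LinearMap.id :=
    iInf_mono' fun j => (h j).imp fun _ hj => hj.1
  have hge : (⨅ j, (Y j).carrier.comap LinearMap.id) ≤ ⨅ i, (X i).carrier.comap LinearMap.id :=
    iInf_mono' fun i => (h' i).imp fun _ hi => hi.1
  exact TopSubspace.ext_of_continuous (le_antisymm hle hge)
    (continuous_inclusion_projectiveLimit h _) (continuous_inclusion_projectiveLimit h' _)

theorem quot_le_of_le_mul {K : Set (EuclideanSpace ℝ (Fin d))} {M N : ℕ → ℝ} {C : ℝ} (hC : 0 < C)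
    (hM : ∀ p, 0 < M p) (h : ∀ p, M p ≤ C * N p) (F : smoothCompact K)
    (q : (Fin d → ℕ) × K) : quot K N F q ≤ C * quot K M F q := by
  unfold quot
  set p := ∑ i, q.1 i
  have hN : 0 < N p := by
    by_contra! hn
    nlinarith [hM p, h p]
  rw [abs_of_pos (hM p), abs_of_pos hN, ← mul_div_assoc, div_le_div_iff₀ hN (hM p)]
  nlinarith [h p, norm_nonneg (F.1 q.1 q.2)]

theorem continuous_inclusion_udSpace {K : Set (EuclideanSpace ℝ (Fin d))} {M N : ℕ → ℝ}
    (hM : ∀ p, 0 < M p) (h : Dominated M N) :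
    ∃ hle : udSpace K M ≤ udSpace K N, @Continuous _ _ (udTopology K M) (udTopology K N)
      (Submodule.inclusion hle) := by
  obtain ⟨C, hC, hMN⟩ := h
  have hq := quot_le_of_le_mul (K := K) hC hM hMN
  have hle : udSpace K M ≤ udSpace K N := by
    rintro F ⟨b, hb⟩
    refine ⟨C * b, ?_⟩
    rintro _ ⟨q, rfl⟩
    exact (hq F q).trans (mul_le_mul_of_nonneg_left (hb ⟨q, rfl⟩) hC.le)
  refine ⟨hle, ?_⟩
  let i1 := (udNorm K M).toAddGroupSeminorm.toSeminormedAddCommGroup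
  let i2 := (udNorm K N).toAddGroupSeminorm.toSeminormedAddCommGroup
  refine AddMonoidHomClass.continuous_of_bound (Submodule.inclusion hle) C fun F => ?_
  change (⨆ q, quot K N F.1 q) ≤ C * ⨆ q, quot K M F.1 q
  refine Real.iSup_le (fun q => (hq F.1 q).trans ?_)
    (mul_nonneg hC.le (Real.iSup_nonneg (quot_nonneg K M F.1)))
  exact mul_le_mul_of_nonneg_left (le_ciSup F.2 q) hC.le

theorem roumieuClass_eq {U : Set (EuclideanSpace ℝ (Fin d))} (hU : IsOpen U) {M N : ℝ → ℕ → ℝ}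
    (hM : ∀ a > 0, ∀ p, 0 < M a p) (hN : ∀ a > 0, ∀ p, 0 < N a p)
    (hMN : ∀ a > 0, ∃ b > 0, Dominated (M a) (N b))
    (hNM : ∀ b > 0, ∃ a > 0, Dominated (N b) (M a)) :
    roumieuClass hU M = roumieuClass hU N := by
  unfold roumieuClass
  congr 1
  funext K
  refine inductiveLimit_eq (fun a => ?_) fun b => ?_
  · obtain ⟨b, hb, h⟩ := hMN a a.2
    exact ⟨⟨b, hb⟩, continuous_inclusion_udSpace (hM a a.2) h⟩
  · obtain ⟨a, ha, h⟩ := hNM b b.2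
    exact ⟨⟨a, ha⟩, continuous_inclusion_udSpace (hN b b.2) h⟩

theorem beurlingClass_eq {U : Set (EuclideanSpace ℝ (Fin d))} (hU : IsOpen U) {M N : ℝ → ℕ → ℝ}
    (hM : ∀ a > 0, ∀ p, 0 < M a p) (hN : ∀ a > 0, ∀ p, 0 < N a p)
    (hMN : ∀ b > 0, ∃ a > 0, Dominated (M a) (N b))
    (hNM : ∀ a > 0, ∃ b > 0, Dominated (N b) (M a)) :
    beurlingClass hU M = beurlingClass hU N := by
  unfold beurlingClass
  congr 1
  funext K
  refine projectiveLimit_eq (fun b => ?_) fun a => ?_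
  · obtain ⟨a, ha, h⟩ := hMN b b.2
    exact ⟨⟨a, ha⟩, continuous_inclusion_udSpace (hM a ha) h⟩
  · obtain ⟨b, hb, h⟩ := hNM a a.2
    exact ⟨⟨b, hb⟩, continuous_inclusion_udSpace (hN b hb) h⟩

end ExtGevrey

theorem theorem1 (σ : ℝ) (hσ : 1 < σ) :
    -- (i)
    (ExtGevrey.EquivalentToWeight (fun k => ExtGevrey.phi σ (Real.posLog |k|)) ∧
      ∀ h τ : ℝ, 0 < h → 0 < τ →
        (∀ k : ℝ, 0 < k → BddAbove (Set.range (ExtGevrey.assocTerm σ τ h k))) ∧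
        ExtGevrey.EquivalentToWeight (fun k => ExtGevrey.assocFun σ τ h |k|)) ∧
    -- (ii)
    ((∀ y : ℝ, 0 ≤ y →
        BddAbove (Set.range (fun t : Set.Ioi (0 : ℝ) => y * t - ExtGevrey.phi σ t))) ∧
      ExtGevrey.IsWeightMatrix (ExtGevrey.gevreyMatrix σ) ∧
      ExtGevrey.IsWeightMatrix (ExtGevrey.youngMatrix σ) ∧
      ExtGevrey.MatrixEquiv (ExtGevrey.gevreyMatrix σ) (ExtGevrey.youngMatrix σ) ∧
      ∀ (d : ℕ) (U : Set (EuclideanSpace ℝ (Fin d))) (hU : IsOpen U),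
        ExtGevrey.beurlingClass hU (ExtGevrey.youngSeq σ) =
          ExtGevrey.beurlingClass hU (ExtGevrey.gevreySeq σ) ∧
        ExtGevrey.roumieuClass hU (ExtGevrey.youngSeq σ) =
          ExtGevrey.roumieuClass hU (ExtGevrey.gevreySeq σ)) := by
  open ExtGevrey in
  exact ⟨⟨⟨_, isWeightFunction_phi hσ, isBigO_refl _ _, isBigO_refl _ _⟩, fun h τ hh hτ =>
      ⟨fun k hk => bddAbove_assocTerm hσ hτ hh hk, equivalentToWeight_assocFun hσ hτ hh⟩⟩,
    fun y hy => bddAbove_mul_sub_phi hσ hy,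
    isWeightMatrix_gevreyMatrix hσ, isWeightMatrix_youngMatrix hσ,
    matrixEquiv_gevreyMatrix_youngMatrix hσ, fun d U hU =>
    ⟨beurlingClass_eq hU (fun H _ => youngSeq_pos σ H) (fun τ _ => gevreySeq_pos hσ τ)
        (fun _ hτ => exists_youngSeq_dominated_small hσ hτ)
        (fun _ hH => exists_gevreySeq_dominated_small hσ hH),
      roumieuClass_eq hU (fun H _ => youngSeq_pos σ H) (fun τ _ => gevreySeq_pos hσ τ)
        (fun _ hH => exists_youngSeq_dominated_large hσ hH)
        (fun _ _ => exists_gevreySeq_dominated_large hσ)⟩⟩
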